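/- Let $G$ be a finite simple graph whose vertex set is partitioned into nonempty blocks, each of size at least $b$. Suppose that for each block the average, over the vertices in the block, of their degrees in $G$ is at most $d$. A *transversal* is a set of vertices containing exactly one vertex from each block. Then: (R1) if $b\ge 4d$, then $G$ has an independent transversal, i.e. a transversal containing no edge of $G$; (R2) if $b\ge 2d$, then $G$ has a transversal $A$ such that the induced subgraph $G[A]$ has no connected component with more than $2$ vertices; (R3) if $b\ge \tfrac43 d$, then $G$ has a transversal $A$ such that the induced subgraph $G[A]$ contains no 3-clique $K_3$. Furthermore, these transversals can be constructed in expected polynomial time: for each of the three cases there are a fixed randomized algorithm and a fixed polynomial $p$ such that, for every graph $G$ on $n$ vertices with a partition into blocks that satisfies the hypotheses of that case for some $b$ and $d$, the algorithm, given the adjacency matrix of $G$ and the block of each vertex, halts after an expected number of at most $p(n)$ steps and always outputs, upon halting, a transversal as described in that case. The algorithm runs on a random access machine whose unit-cost operations are reading and writing memory, addition, truncated subtraction, tests for zero, and drawing a uniformly random element of $\{0,\dots,k\}$ for a number $k$ in memory. -/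

import Mathlib

/-! ### Graphs with a partition into blocks -/

/-- The average degree (in `G`) of the vertices of block `i`, where `block v` is the block
containing the vertex `v`. -/
noncomputable def blockAvgDegree {V ι : Type*} [Fintype V] [DecidableEq ι]
    (G : SimpleGraph V) [DecidableRel G.Adj] (block : V → ι) (i : ι) : ℝ :=
  (∑ v ∈ Finset.univ.filter (fun v => block v = i), (G.degree v : ℝ)) /
    ((Finset.univ.filter (fun v => block v = i)).card : ℝ)

/-- The fibres of `block` are a partition of the vertex set of `G` into (nonempty) blocks of size
at least `b`, and the average degree of the vertices in each block is at most `d`. -/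
structure IsBlockPartition {V ι : Type*} [Fintype V] [DecidableEq ι]
    (G : SimpleGraph V) [DecidableRel G.Adj] (block : V → ι) (b : ℕ) (d : ℝ) : Prop where
  nonempty : Function.Surjective block
  size : ∀ i, b ≤ (Finset.univ.filter (fun v => block v = i)).card
  avgDegree : ∀ i, blockAvgDegree G block i ≤ d

/-- A transversal: a set of vertices with exactly one vertex in each block. -/
def IsTransversal {V ι : Type*} (block : V → ι) (A : Set V) : Prop :=
  ∀ i, ∃! v, v ∈ A ∧ block v = i

/-- The subgraph induced on `A` has no connected component with more than two vertices. -/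
def NoComponentAboveTwo {V : Type*} (G : SimpleGraph V) (A : Set V) : Prop :=
  ∀ C : (G.induce A).ConnectedComponent, C.supp.encard ≤ 2

/-- The subgraph induced on `A` has no 3-clique. -/
def NoTriangle {V : Type*} (G : SimpleGraph V) (A : Set V) : Prop :=
  (G.induce A).CliqueFree 3

/-! ### A randomized random access machine

Programs of a small imperative language over finitely many (unbounded) arrays of natural numbers.
Arithmetic is restricted to addition and truncated subtraction, so that the numbers in memory have
at most linearly many bits in the running time plus the input, and unit cost is polynomially
related to Turing machine time. -/

/-- The memory: `σ a i` is the content of cell `i` of array `a`. -/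
abbrev Store : Type := ℕ → ℕ → ℕ

/-- Expressions. A literal, cell `a[i]`, sum, truncated difference. -/
inductive Expr : Type where
  | lit (k : ℕ) : Expr
  | cell (a : ℕ) (i : Expr) : Expr
  | add (e f : Expr) : Expr
  | sub (e f : Expr) : Expr

def Expr.eval (σ : Store) : Expr → ℕ
  | .lit k => k
  | .cell a i => σ a (i.eval σ)
  | .add e f => e.eval σ + f.eval σ
  | .sub e f => e.eval σ - f.eval σ

/-- Commands. The array names are fixed by the program, the indices are computed. -/
inductive Cmd : Type where
  /-- do nothing -/
  | nop : Cmd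
  /-- `a[i] := e` -/
  | assign (a : ℕ) (i e : Expr) : Cmd
  /-- `a[i] :=` a fresh uniformly random element of `{0, 1, …, e}` -/
  | draw (a : ℕ) (i e : Expr) : Cmd
  /-- `c` and then `c'` -/
  | seq (c c' : Cmd) : Cmd
  /-- if `e ≠ 0` then `c` else `c'` -/
  | branch (e : Expr) (c c' : Cmd) : Cmd
  /-- while `e ≠ 0` do `c` -/
  | loop (e : Expr) (c : Cmd) : Cmd

/-- Write `x` into cell `i` of array `a`. -/
def Store.write (σ : Store) (a i x : ℕ) : Store :=
  Function.update σ a (Function.update (σ a) i x)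

/-- A configuration: the commands that remain to be executed, in order, and the memory.
The machine has halted when no command remains. -/
abbrev Config : Type := List Cmd × Store

/-- One step of the machine, as a probability distribution on the next configuration. A step
evaluates the boundedly many expressions of one command. -/
noncomputable def step : Config → PMF Config
  | ([], σ) => PMF.pure ([], σ)
  | (.nop :: K, σ) => PMF.pure (K, σ)
  | (.assign a i e :: K, σ) => PMF.pure (K, σ.write a (i.eval σ) (e.eval σ))
  | (.draw a i e :: K, σ) =>
      (PMF.uniformOfFintype (Fin (e.eval σ + 1))).map
        (fun x => (K, σ.write a (i.eval σ) x.val))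
  | (.seq c c' :: K, σ) => PMF.pure (c :: c' :: K, σ)
  | (.branch e c c' :: K, σ) => PMF.pure ((if e.eval σ ≠ 0 then c else c') :: K, σ)
  | (.loop e c :: K, σ) =>
      PMF.pure (if e.eval σ ≠ 0 then c :: .loop e c :: K else K, σ)

/-- The distribution of the configuration after `k` steps. -/
noncomputable def runDist : ℕ → Config → PMF Config
  | 0, x => PMF.pure x
  | k + 1, x => (step x).bind (runDist k)

/-- The expected number of steps until the machine halts, `E[T] = ∑ₖ P(T > k)`; it is `∞` if the
machine fails to halt with positive probability. -/
noncomputable def expectedTime (x : Config) : ENNReal :=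
  ∑' k : ℕ, (runDist k x).toOuterMeasure {y | y.1 ≠ []}

/-! ### Input, output, and constructibility in expected polynomial time -/

open Classical in
/-- The memory that holds the graph `G` on `{0, …, n - 1}` and its blocks `0, …, l - 1`:
array `0` holds `n` and `l`, array `1` the block of each vertex, array `2` the adjacency matrix,
row by row. All other cells are `0`. -/
noncomputable def inputStore {n l : ℕ} (G : SimpleGraph (Fin n)) (block : Fin n → Fin l) : Store
  | 0, i => if i = 0 then n else if i = 1 then l else 0
  | 1, i => if h : i < n then (block ⟨i, h⟩).val else 0
  | 2, i => if ∃ u v : Fin n, i = u.val * n + v.val ∧ G.Adj u v then 1 else 0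
  | _ + 3, _ => 0

/-- The set of vertices listed in the first `l` cells of the output array `3`. -/
def outputSet (n l : ℕ) (σ : Store) : Set (Fin n) :=
  {v | ∃ i : Fin l, σ 3 i.val = v.val}

/-- There is one randomized program which, on every graph on `n` vertices that is partitioned into
blocks of size at least `b` with average degrees at most `d`, where `b ≥ c d`, has expected running
time at most a fixed polynomial in `n`, and which, whenever it halts, has output a transversal with
the property `Good`. The numbers `b` and `d` are not given to the program. -/
def ConstructibleInExpectedPolyTime (c : ℝ)
    (Good : ∀ n : ℕ, SimpleGraph (Fin n) → Set (Fin n) → Prop) : Prop :=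
  ∃ (prog : Cmd) (p : Polynomial ℕ),
    ∀ (n l : ℕ) (G : SimpleGraph (Fin n)) [DecidableRel G.Adj] (block : Fin n → Fin l)
      (b : ℕ) (d : ℝ), IsBlockPartition G block b d → c * d ≤ (b : ℝ) →
      expectedTime ([prog], inputStore G block) ≤ ((p.eval n : ℕ) : ENNReal) ∧
      ∀ (k : ℕ) (σ : Store),
        (([], σ) : Config) ∈ (runDist k ([prog], inputStore G block)).support →
        IsTransversal block (outputSet n l σ) ∧ Good n G (outputSet n l σ)

/-! The algorithm is Moser–Tardos resampling in which only part of a violated pattern is redrawn. A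
uniform representative is drawn in each of the `l` blocks. While the representatives contain an
edge, a three-vertex path or a triangle (`κ = 0, 1, 2`), one of the `k = κ + 1` edges of that
pattern is chosen uniformly, and the representatives of its two blocks are redrawn. A given edge of
the pattern is thus blamed only with probability `1 / k`, which gives the three constants `4 / k`.

Blame is recorded in binary trees of edges, where a child shares a block with its parent. The weight
of a tree at representatives `x` is `k⁻¹` to the number of nodes times the probability that,
starting from `x` and with fresh draws afterwards, the vertices of its edges turn up in the order of
resampling. The potential is the total weight of all nonempty trees. In one resampling, a tree that
does not meet the chosen edge keeps its weight on average. A tree that is empty or meets the chosen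
edge `f` acquires the weight of the larger tree `insert blk f τ`. The `k` edges pairwise share a
block, so `insert_inj` makes the larger trees distinct, and each of them meets all `k` edges. Hence
one plus the new potential averages to at most the old potential (`sum_blockAvg_potential_le`).

For independent uniform representatives a tree weighs the product of `1 / (k |B| |B'|)` over its
edges, `B` and `B'` being the two blocks. At most `d |B|` edges leave a block `B`, so their weights
sum to at most `d / (k b) ≤ 1 / 4`, and the recursion `t = 1 + t² / 4` with fixed point `2` bounds
the nonempty trees rooted at one block by `1` (`tsum_labelProd_le`). The initial potential therefore
averages to at most `l`, and so does the number of resamplings.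

The expected time calculus `Cmd.ert` turns this into a bound for the actual program, and
`ert_search_le` uses the potential in its loop bound. Existence of the transversals follows because
a program with finite expected time can halt. -/

/-! ### Expected running times of programs -/

/-- The expectation of a nonnegative function. -/
noncomputable def PMF.lexp {α : Type*} (p : PMF α) (f : α → ENNReal) : ENNReal :=
  ∑' a, p a * f a

theorem PMF.lexp_pure {α : Type*} (a : α) (f : α → ENNReal) : (PMF.pure a).lexp f = f a := by
  classical
  unfold PMF.lexp
  rw [tsum_eq_single a]
  · simp
  · intro b hb
    simp [PMF.pure_apply, hb]

theorem PMF.lexp_bind {α β : Type*} (p : PMF α) (q : α → PMF β) (f : β → ENNReal) :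
    (p.bind q).lexp f = p.lexp (fun a => (q a).lexp f) := by
  unfold PMF.lexp
  simp only [PMF.bind_apply, ← ENNReal.tsum_mul_right, ← ENNReal.tsum_mul_left]
  rw [ENNReal.tsum_comm]
  simp only [mul_assoc]

theorem PMF.lexp_map {α β : Type*} (p : PMF α) (h : α → β) (f : β → ENNReal) :
    (p.map h).lexp f = p.lexp (fun a => f (h a)) := by
  rw [← PMF.bind_pure_comp, PMF.lexp_bind]
  simp only [Function.comp, PMF.lexp_pure]

theorem PMF.lexp_mono {α : Type*} (p : PMF α) {f g : α → ENNReal} (h : ∀ a, f a ≤ g a) :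
    p.lexp f ≤ p.lexp g :=
  ENNReal.tsum_le_tsum fun a => mul_le_mul_right (h a) _

theorem PMF.lexp_uniform_fin (k : ℕ) (f : Fin (k + 1) → ENNReal) :
    (PMF.uniformOfFintype (Fin (k + 1))).lexp f = ∑ x, ((k : ENNReal) + 1)⁻¹ * f x := by
  unfold PMF.lexp
  rw [tsum_fintype]
  simp

theorem PMF.lexp_add {α : Type*} (p : PMF α) (f g : α → ENNReal) :
    p.lexp (fun a => f a + g a) = p.lexp f + p.lexp g := by
  unfold PMF.lexp
  simp only [mul_add, ENNReal.tsum_add]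

theorem PMF.lexp_sum {α κ : Type*} (p : PMF α) (s : Finset κ) (f : κ → α → ENNReal) :
    p.lexp (fun a => ∑ i ∈ s, f i a) = ∑ i ∈ s, p.lexp (f i) := by
  classical
  induction s using Finset.induction_on with
  | empty => simp [PMF.lexp]
  | insert i s hi ih => simp only [Finset.sum_insert hi, PMF.lexp_add, ih]

/-! ### Truncated running times and the expected time calculus -/

/-- The reward `g` for halting memories, and `0` for running machines. -/
noncomputable def haltReward (g : Store → ENNReal) : Config → ENNReal
  | ([], σ) => g σ
  | (_ :: _, _) => 0

/-- `1` for running machines, `0` for halted ones. -/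
noncomputable def running : Config → ENNReal
  | ([], _) => 0
  | (_ :: _, _) => 1

/-- The expected number of steps among the first `m` ones plus the expected reward of
having halted by then. -/
noncomputable def truncTime (g : Store → ENNReal) : ℕ → Config → ENNReal
  | 0, x => haltReward g x
  | m + 1, x => running x + (step x).lexp (truncTime g m)

theorem truncTime_nil (g : Store → ENNReal) (m : ℕ) (σ : Store) :
    truncTime g m ([], σ) = g σ := by
  induction m with
  | zero => rfl
  | succ m ih => simp [truncTime, running, step, PMF.lexp_pure, ih]

theorem truncTime_le_succ (g : Store → ENNReal) (m : ℕ) (x : Config) :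
    truncTime g m x ≤ truncTime g (m + 1) x := by
  induction m generalizing x with
  | zero =>
    rcases x with ⟨_ | ⟨c, K⟩, σ⟩
    · rw [truncTime_nil, truncTime_nil]
    · exact zero_le
  | succ m ih =>
    rw [truncTime, truncTime]
    exact add_le_add_right (PMF.lexp_mono _ ih) _

theorem truncTime_eq (g : Store → ENNReal) (m : ℕ) (x : Config) :
    truncTime g m x =
      ∑ k ∈ Finset.range m, (runDist k x).lexp running + (runDist m x).lexp (haltReward g) := by
  induction m generalizing x with
  | zero => simp [truncTime, runDist, PMF.lexp_pure]
  | succ m ih =>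
    rw [truncTime, Finset.sum_range_succ']
    simp only [runDist, PMF.lexp_pure, PMF.lexp_bind]
    rw [show truncTime g m = _ from funext ih, PMF.lexp_add, PMF.lexp_sum]
    ring

theorem lexp_running_eq (p : PMF Config) :
    p.lexp running = p.toOuterMeasure {y | y.1 ≠ []} := by
  rw [PMF.toOuterMeasure_apply]
  unfold PMF.lexp
  congr 1
  funext y
  rcases y with ⟨_ | ⟨c, K⟩, σ⟩ <;> simp [running, Set.indicator]

/-- A uniform bound on the truncated running times with infinite reward for memories violating
`Post` bounds the expected time and shows partial correctness. -/
theorem expectedTime_le_and_support_of_truncTime_le {x : Config} {Post : Store → Prop}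
    {B : ENNReal} {g : Store → ENNReal} (hg : ∀ σ, ¬ Post σ → g σ = ⊤) (hB : B ≠ ⊤)
    (h : ∀ m, truncTime g m x ≤ B) :
    expectedTime x ≤ B ∧
      ∀ (k : ℕ) (σ : Store), (([], σ) : Config) ∈ (runDist k x).support → Post σ := by
  constructor
  · refine ENNReal.tsum_le_of_sum_range_le fun m => ?_
    refine le_trans ?_ (h m)
    rw [truncTime_eq]
    simp only [lexp_running_eq]
    exact le_self_add
  · intro k σ hσ
    by_contra hP
    apply hB
    rw [← top_le_iff]
    refine le_trans ?_ (h k)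
    rw [truncTime_eq]
    refine le_trans ?_ le_add_self
    refine le_trans ?_ (ENNReal.le_tsum (([], σ) : Config))
    -- A wrong output of positive probability would contribute an infinite term to a finite bound.
    rw [haltReward, hg σ hP, ENNReal.mul_top ((PMF.mem_support_iff _ _).1 hσ)]

/-- Expected running time calculus: `c.ert g σ` is the expected time for running `c` from `σ`
and then spending time `g`. Loops are described by their inductive upper bounds. -/
noncomputable def Cmd.ert : Cmd → (Store → ENNReal) → Store → ENNReal
  | .nop, g, σ => 1 + g σ
  | .assign a i e, g, σ => 1 + g (σ.write a (i.eval σ) (e.eval σ))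
  | .draw a i e, g, σ =>
      1 + ∑ x ∈ Finset.range (e.eval σ + 1),
        ((e.eval σ : ENNReal) + 1)⁻¹ * g (σ.write a (i.eval σ) x)
  | .seq c c', g, σ => 1 + c.ert (c'.ert g) σ
  | .branch e c c', g, σ => 1 + if e.eval σ ≠ 0 then c.ert g σ else c'.ert g σ
  | .loop e c, g, σ =>
      sInf {I : Store → ENNReal |
        ∀ ρ, 1 + (if e.eval ρ ≠ 0 then c.ert I ρ else g ρ) ≤ I ρ} σ

theorem Cmd.ert_branch (e : Expr) (c c' : Cmd) (g : Store → ENNReal) (σ : Store) :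
    (Cmd.branch e c c').ert g σ = 1 + bif e.eval σ == 0 then c'.ert g σ else c.ert g σ := by
  by_cases h : e.eval σ = 0
  · simp [Cmd.ert, h]
  · simp [Cmd.ert, h, beq_eq_false_iff_ne.2 h]

theorem Cmd.ert_nop (g : Store → ENNReal) (σ : Store) : Cmd.nop.ert g σ = 1 + g σ := rfl

theorem Cmd.ert_assign (a : ℕ) (i e : Expr) (g : Store → ENNReal) (σ : Store) :
    (Cmd.assign a i e).ert g σ = 1 + g (σ.write a (i.eval σ) (e.eval σ)) := rfl

theorem Cmd.ert_seq (c c' : Cmd) (g : Store → ENNReal) (σ : Store) :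
    (Cmd.seq c c').ert g σ = 1 + c.ert (c'.ert g) σ := rfl

theorem Cmd.ert_loop_le {e : Expr} {c : Cmd} {g I : Store → ENNReal}
    (h0 : ∀ ρ, e.eval ρ = 0 → 1 + g ρ ≤ I ρ) (h1 : ∀ ρ, e.eval ρ ≠ 0 → 1 + c.ert I ρ ≤ I ρ)
    (σ : Store) : (Cmd.loop e c).ert g σ ≤ I σ := by
  refine (sInf_le ?_ : sInf _ ≤ I) σ
  intro ρ
  split_ifs with h
  · exact h1 ρ h
  · exact h0 ρ (not_not.1 h)

/-- Variant of `Cmd.ert_loop_le` where the bound is only shown under an invariant. -/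
theorem Cmd.ert_loop_le_of_inv {e : Expr} {c : Cmd} {g I : Store → ENNReal} {P : Store → Prop}
    (h0 : ∀ ρ, P ρ → e.eval ρ = 0 → 1 + g ρ ≤ I ρ)
    (h1 : ∀ (ρ : Store) (J : Store → ENNReal), (∀ τ, P τ → J τ = I τ) → P ρ → e.eval ρ ≠ 0 →
      1 + c.ert J ρ ≤ I ρ) {σ : Store} (hσ : P σ) : (Cmd.loop e c).ert g σ ≤ I σ := by
  classical
  have := Cmd.ert_loop_le (e := e) (c := c) (g := g) (I := fun ρ => if P ρ then I ρ else ⊤)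
    (fun ρ h => by
      split_ifs with hP
      · exact h0 ρ hP h
      · exact le_top)
    (fun ρ h => by
      split_ifs with hP
      · exact h1 ρ _ (fun τ hτ => if_pos hτ) hP h
      · exact le_top) σ
  simpa [hσ] using this

/-- Soundness of the calculus. The continuation `K` enters only through its bound `g`, so structural
induction works. For a loop, any inductive bound `I` suffices, by a second induction on the number
`m` of steps. -/
theorem truncTime_le_ert (G : Store → ENNReal) (c : Cmd) (K : List Cmd) (g : Store → ENNReal)
    (m : ℕ) (h : ∀ σ, truncTime G m (K, σ) ≤ g σ) (σ : Store) :
    truncTime G m (c :: K, σ) ≤ c.ert g σ := by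
  induction c generalizing K g m σ with
  | nop =>
    cases m with
    | zero => exact zero_le
    | succ m =>
      simp only [truncTime, running, step, PMF.lexp_pure, Cmd.ert]
      exact add_le_add_right ((truncTime_le_succ _ _ _).trans (h _)) _
  | assign a i e =>
    cases m with
    | zero => exact zero_le
    | succ m =>
      simp only [truncTime, running, step, PMF.lexp_pure, Cmd.ert]
      exact add_le_add_right ((truncTime_le_succ _ _ _).trans (h _)) _
  | draw a i e =>
    cases m with
    | zero => exact zero_le
    | succ m =>
      simp only [truncTime, running, step, PMF.lexp_map, Cmd.ert, PMF.lexp_uniform_fin]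
      rw [Finset.sum_range
        (fun x => ((e.eval σ : ENNReal) + 1)⁻¹ * g (σ.write a (i.eval σ) x))]
      exact add_le_add_right (Finset.sum_le_sum fun x _ =>
        mul_le_mul_right ((truncTime_le_succ _ _ _).trans (h _)) _) _
  | seq c c' ih ih' =>
    cases m with
    | zero => exact zero_le
    | succ m =>
      simp only [truncTime, running, step, PMF.lexp_pure, Cmd.ert]
      exact add_le_add_right (ih _ _ _ (fun ρ => ih' _ _ _
        (fun τ => (truncTime_le_succ _ _ _).trans (h τ)) ρ) σ) _
  | branch e c c' ih ih' =>
    cases m with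
    | zero => exact zero_le
    | succ m =>
      simp only [truncTime, running, step, PMF.lexp_pure, Cmd.ert]
      split_ifs
      · exact add_le_add_right (ih _ _ _ (fun τ => (truncTime_le_succ _ _ _).trans (h τ)) σ) _
      · exact add_le_add_right (ih' _ _ _ (fun τ => (truncTime_le_succ _ _ _).trans (h τ)) σ) _
  | loop e c ih =>
    simp only [Cmd.ert, sInf_apply]
    refine le_iInf fun ⟨I, hI⟩ => ?_
    change _ ≤ I σ
    induction m generalizing σ with
    | zero => exact zero_le
    | succ m ihm =>
      have hm := fun τ => (truncTime_le_succ G m (K, τ)).trans (h τ)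
      refine le_trans ?_ (hI σ)
      simp only [truncTime, running, step, PMF.lexp_pure]
      split_ifs
      · exact add_le_add_right (ih _ _ _ (fun τ => ihm hm τ) σ) _
      · exact add_le_add_right (hm σ) _

/-- A finite bound on `ert` gives total correctness with the same bound on the expected time. -/
theorem expectedTime_le_and_support_of_ert_le {c : Cmd} {σ : Store} {Post : Store → Prop}
    {B : ENNReal} {g : Store → ENNReal} (hg : ∀ ρ, ¬ Post ρ → g ρ = ⊤) (hB : B ≠ ⊤)
    (h : c.ert g σ ≤ B) :
    expectedTime ([c], σ) ≤ B ∧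
      ∀ (k : ℕ) (ρ : Store), (([], ρ) : Config) ∈ (runDist k ([c], σ)).support → Post ρ :=
  expectedTime_le_and_support_of_truncTime_le hg hB fun m =>
    (truncTime_le_ert g c [] g m (fun ρ => (truncTime_nil g m ρ).le) σ).trans h

/-- A machine with finite expected running time can halt. -/
theorem exists_halted_of_expectedTime_ne_top {x : Config} (h : expectedTime x ≠ ⊤) :
    ∃ (k : ℕ) (σ : Store), (([], σ) : Config) ∈ (runDist k x).support := by
  by_contra! hne
  apply h
  have h1 : ∀ k, (runDist k x).toOuterMeasure {y | y.1 ≠ []} = 1 := by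
    intro k
    rw [PMF.toOuterMeasure_apply_eq_one_iff]
    rintro ⟨_ | ⟨c, K⟩, σ⟩ hy
    · exact absurd hy (hne k σ)
    · simp
  simp only [expectedTime, h1]
  exact ENNReal.tsum_const_eq_top_of_ne_zero one_ne_zero

/-! ### Averaging over blocks -/

/-- The average of `g` over all ways to change the representative of block `i` to an element
of `B i`. -/
noncomputable def blockAvg (B : ℕ → Finset ℕ) (i : ℕ) (g : (ℕ → ℕ) → ENNReal) (x : ℕ → ℕ) :
    ENNReal :=
  ((B i).card : ENNReal)⁻¹ * ∑ a ∈ B i, g (Function.update x i a)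

/-- The vertex `u` is required to be the representative of its block, and then the block
is resampled. -/
noncomputable def resampleAt (B : ℕ → Finset ℕ) (blk : ℕ → ℕ) (u : ℕ)
    (g : (ℕ → ℕ) → ENNReal) (x : ℕ → ℕ) : ENNReal :=
  if x (blk u) = u then blockAvg B (blk u) g x else 0

/-- The probability that, in a resampling table with current representatives `x`, the vertices of
the list are met in this order. -/
noncomputable def listWeight (B : ℕ → Finset ℕ) (blk : ℕ → ℕ) (t : List ℕ) :
    (ℕ → ℕ) → ENNReal :=
  t.foldr (resampleAt B blk) (fun _ => 1)

/-- The average over all representatives of the `c` blocks starting with block `s`. -/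
noncomputable def blocksAvg (B : ℕ → Finset ℕ) : ℕ → ℕ → ((ℕ → ℕ) → ENNReal) → (ℕ → ℕ) → ENNReal
  | 0, _, g => g
  | c + 1, s, g => blockAvg B s (blocksAvg B c (s + 1) g)

section Averages

variable {B : ℕ → Finset ℕ} {blk : ℕ → ℕ}

theorem blockAvg_const {i : ℕ} (hi : (B i).Nonempty) (c : ENNReal) :
    blockAvg B i (fun _ => c) = fun _ => c := by
  funext x
  have h0 : ((B i).card : ENNReal) ≠ 0 := by simpa using hi.ne_empty
  simp only [blockAvg, Finset.sum_const, nsmul_eq_mul, ← mul_assoc]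
  rw [ENNReal.inv_mul_cancel h0 (ENNReal.natCast_ne_top _), one_mul]

theorem blockAvg_add (i : ℕ) (g h : (ℕ → ℕ) → ENNReal) (x : ℕ → ℕ) :
    blockAvg B i (fun y => g y + h y) x = blockAvg B i g x + blockAvg B i h x := by
  simp only [blockAvg, Finset.sum_add_distrib, mul_add]

theorem blockAvg_mul (i : ℕ) (c : ENNReal) (g : (ℕ → ℕ) → ENNReal) (x : ℕ → ℕ) :
    blockAvg B i (fun y => c * g y) x = c * blockAvg B i g x := by
  simp only [blockAvg, ← Finset.mul_sum]
  ring

theorem blockAvg_tsum {κ : Type*} (i : ℕ) (g : κ → (ℕ → ℕ) → ENNReal) (x : ℕ → ℕ) :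
    blockAvg B i (fun y => ∑' j, g j y) x = ∑' j, blockAvg B i (g j) x := by
  simp only [blockAvg, ENNReal.tsum_mul_left]
  rw [Summable.tsum_finsetSum (fun _ _ => ENNReal.summable)]

theorem blockAvg_congr {i : ℕ} {g h : (ℕ → ℕ) → ENNReal} {x : ℕ → ℕ}
    (H : ∀ a ∈ B i, g (Function.update x i a) = h (Function.update x i a)) :
    blockAvg B i g x = blockAvg B i h x := by
  simp only [blockAvg, Finset.sum_congr rfl H]

theorem blockAvg_update (i a : ℕ) (g : (ℕ → ℕ) → ENNReal) (x : ℕ → ℕ) :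
    blockAvg B i g (Function.update x i a) = blockAvg B i g x := by
  simp only [blockAvg, Function.update_idem]

theorem blockAvg_comm {i j : ℕ} (hij : i ≠ j) (g : (ℕ → ℕ) → ENNReal) :
    blockAvg B i (blockAvg B j g) = blockAvg B j (blockAvg B i g) := by
  funext x
  simp only [blockAvg, Finset.mul_sum]
  rw [Finset.sum_comm]
  refine Finset.sum_congr rfl fun a _ => Finset.sum_congr rfl fun b _ => ?_
  rw [Function.update_comm hij]
  ring

/-- Operations on different blocks act on different coordinates. All commutation facts about
resampling orders come from this. -/
theorem blockAvg_resampleAt_of_ne {i u : ℕ} (h : i ≠ blk u) (g : (ℕ → ℕ) → ENNReal) :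
    blockAvg B i (resampleAt B blk u g) = resampleAt B blk u (blockAvg B i g) := by
  funext x
  have h1 : ∀ a, Function.update x i a (blk u) = x (blk u) := fun a =>
    Function.update_of_ne h.symm _ _
  by_cases hx : x (blk u) = u
  · simp only [resampleAt, if_pos hx, blockAvg_comm h.symm]
    exact blockAvg_congr fun a _ => by simp only [resampleAt, h1, hx, if_true]
  · simp [resampleAt, blockAvg, h1, hx]

/-- A uniform representative equals `u` with probability one over the block size, and the resampling
that follows erases this information. -/
theorem blockAvg_resampleAt_self {u : ℕ} (hu : u ∈ B (blk u)) (g : (ℕ → ℕ) → ENNReal)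
    (x : ℕ → ℕ) : blockAvg B (blk u) (resampleAt B blk u g) x =
      ((B (blk u)).card : ENNReal)⁻¹ * blockAvg B (blk u) g x := by
  conv_lhs => rw [blockAvg]
  simp only [resampleAt, Function.update_self, blockAvg_update]
  rw [Finset.sum_ite_eq' (B (blk u)) u, if_pos hu]

theorem resampleAt_comm {u v : ℕ} (h : blk u ≠ blk v) (g : (ℕ → ℕ) → ENNReal) :
    resampleAt B blk u (resampleAt B blk v g) = resampleAt B blk v (resampleAt B blk u g) := by
  funext x
  conv_lhs => rw [resampleAt, blockAvg_resampleAt_of_ne h]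
  conv_rhs => rw [resampleAt, blockAvg_resampleAt_of_ne h.symm]
  simp only [resampleAt, blockAvg_comm h]
  split_ifs <;> rfl

theorem resampleAt_resampleAt_of_eq {u v : ℕ} (h : blk u ≠ blk v) {x : ℕ → ℕ}
    (hu : x (blk u) = u) (hv : x (blk v) = v) (g : (ℕ → ℕ) → ENNReal) :
    resampleAt B blk u (resampleAt B blk v g) x =
      blockAvg B (blk u) (blockAvg B (blk v) g) x := by
  rw [resampleAt, if_pos hu, blockAvg_resampleAt_of_ne h, resampleAt, if_pos hv,
    blockAvg_comm h]

theorem listWeight_cons (u : ℕ) (t : List ℕ) :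
    listWeight B blk (u :: t) = resampleAt B blk u (listWeight B blk t) := rfl

theorem listWeight_append_congr (s : List ℕ) {t t' : List ℕ}
    (h : listWeight B blk t = listWeight B blk t') :
    listWeight B blk (s ++ t) = listWeight B blk (s ++ t') := by
  induction s with
  | nil => exact h
  | cons u s ih => simp only [List.cons_append, listWeight_cons, ih]

/-- An entry can be moved to the front past vertices of other blocks. This makes the weight
independent of the order in which unrelated parts of a tree are listed. -/
theorem listWeight_append_cons {u : ℕ} {s : List ℕ} (h : ∀ v ∈ s, blk u ≠ blk v) (t : List ℕ) :
    listWeight B blk (s ++ u :: t) = listWeight B blk (u :: (s ++ t)) := by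
  induction s with
  | nil => rfl
  | cons v s ih =>
    rw [List.cons_append, listWeight_cons, ih fun w hw => h w (List.mem_cons_of_mem _ hw)]
    simp only [List.cons_append, listWeight_cons]
    rw [resampleAt_comm (h v List.mem_cons_self).symm]

theorem blockAvg_listWeight {i : ℕ} (hi : (B i).Nonempty) {t : List ℕ}
    (h : ∀ v ∈ t, i ≠ blk v) : blockAvg B i (listWeight B blk t) = listWeight B blk t := by
  induction t with
  | nil => exact blockAvg_const hi 1
  | cons v t ih =>
    rw [listWeight_cons, blockAvg_resampleAt_of_ne (h v List.mem_cons_self),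
      ih fun w hw => h w (List.mem_cons_of_mem _ hw)]

theorem blocksAvg_mul (c s : ℕ) (a : ENNReal) (g : (ℕ → ℕ) → ENNReal) (x : ℕ → ℕ) :
    blocksAvg B c s (fun y => a * g y) x = a * blocksAvg B c s g x := by
  induction c generalizing s x with
  | zero => rfl
  | succ c ih =>
    simp only [blocksAvg]
    rw [show blocksAvg B c (s + 1) (fun y => a * g y) = _ from funext (ih (s + 1)), blockAvg_mul]

theorem blocksAvg_tsum {κ : Type*} (c s : ℕ) (g : κ → (ℕ → ℕ) → ENNReal) (x : ℕ → ℕ) :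
    blocksAvg B c s (fun y => ∑' j, g j y) x = ∑' j, blocksAvg B c s (g j) x := by
  induction c generalizing s x with
  | zero => rfl
  | succ c ih =>
    simp only [blocksAvg]
    rw [show blocksAvg B c (s + 1) (fun y => ∑' j, g j y) = _ from funext (ih (s + 1)),
      blockAvg_tsum]

theorem blocksAvg_const {c s : ℕ} (hB : ∀ i, s ≤ i → i < s + c → (B i).Nonempty) (a : ENNReal) :
    blocksAvg B c s (fun _ => a) = fun _ => a := by
  induction c generalizing s with
  | zero => rfl
  | succ c ih =>
    rw [blocksAvg, ih fun i h h' => hB i (by omega) (by omega),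
      blockAvg_const (hB s le_rfl (by omega))]

theorem blocksAvg_resampleAt_of_lt {c s u : ℕ} (h : blk u < s) (g : (ℕ → ℕ) → ENNReal) :
    blocksAvg B c s (resampleAt B blk u g) = resampleAt B blk u (blocksAvg B c s g) := by
  induction c generalizing s with
  | zero => rfl
  | succ c ih =>
    rw [blocksAvg, ih (by omega), blockAvg_resampleAt_of_ne (by omega), blocksAvg]

theorem blocksAvg_resampleAt_of_mem {c s u : ℕ} (hu : u ∈ B (blk u)) (h : s ≤ blk u)
    (h' : blk u < s + c) (g : (ℕ → ℕ) → ENNReal) (x : ℕ → ℕ) :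
    blocksAvg B c s (resampleAt B blk u g) x =
      ((B (blk u)).card : ENNReal)⁻¹ * blocksAvg B c s g x := by
  induction c generalizing s x with
  | zero => omega
  | succ c ih =>
    rcases h.eq_or_lt with rfl | h
    · rw [blocksAvg, blocksAvg_resampleAt_of_lt (by omega), blockAvg_resampleAt_self hu, blocksAvg]
    · rw [blocksAvg, show blocksAvg B c (s + 1) (resampleAt B blk u g) = _ from
        funext fun y => ih (s := s + 1) (by omega) (by omega) y, blockAvg_mul, blocksAvg]

/-- Every visit to a block sees a fresh uniform representative, so the probabilities multiply even
if blocks repeat in the list. -/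
theorem blocksAvg_listWeight {l : ℕ} (hB : ∀ i < l, (B i).Nonempty) {t : List ℕ}
    (ht : ∀ u ∈ t, u ∈ B (blk u) ∧ blk u < l) (x : ℕ → ℕ) :
    blocksAvg B l 0 (listWeight B blk t) x =
      (t.map fun u => ((B (blk u)).card : ENNReal)⁻¹).prod := by
  induction t with
  | nil =>
    have := blocksAvg_const (B := B) (c := l) (s := 0) (fun i _ h => hB i (by omega)) 1
    simpa [listWeight] using congrFun this x
  | cons u t ih =>
    obtain ⟨h1, h2⟩ := ht u List.mem_cons_self
    rw [listWeight_cons, blocksAvg_resampleAt_of_mem h1 (Nat.zero_le _) (by omega),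
      ih fun v hv => ht v (List.mem_cons_of_mem _ hv), List.map_cons, List.prod_cons]

end Averages

/-! ### Witness trees -/

/-- Binary trees of edges, where an edge `(u, v)` is a pair of vertices. The two subtrees are
attached at the block of `u` and the block of `v`, respectively. -/
inductive WitnessTree : Type where
  | nil : WitnessTree
  | node (e : ℕ × ℕ) (L R : WitnessTree) : WitnessTree

/-- The edge `f` has an end in block `i`. -/
def EdgeMeetsBlock (blk : ℕ → ℕ) (f : ℕ × ℕ) (i : ℕ) : Prop := blk f.1 = i ∨ blk f.2 = i

/-- There is a block in which both `f` and `g` have an end. -/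
def EdgesMeet (blk : ℕ → ℕ) (f g : ℕ × ℕ) : Prop :=
  EdgeMeetsBlock blk f (blk g.1) ∨ EdgeMeetsBlock blk f (blk g.2)

theorem EdgesMeet.of_block {blk : ℕ → ℕ} {f g : ℕ × ℕ} {i : ℕ} (hf : EdgeMeetsBlock blk f i)
    (hg : EdgeMeetsBlock blk g i) : EdgesMeet blk f g := by
  unfold EdgesMeet EdgeMeetsBlock at *
  grind

namespace WitnessTree

variable {B : ℕ → Finset ℕ} {blk : ℕ → ℕ} {E : Finset (ℕ × ℕ)} {k : ℕ}

def size : WitnessTree → ℕ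
  | nil => 0
  | node _ L R => size L + size R + 1

/-- The edge `f` meets some edge of the tree. -/
def Meets (blk : ℕ → ℕ) (f : ℕ × ℕ) : WitnessTree → Prop
  | nil => False
  | node e L R => EdgesMeet blk f e ∨ Meets blk f L ∨ Meets blk f R

/-- The tree has labels in `E`, its root meets block `i`, and the subtrees meet the ends
where they are attached. -/
def IsWitness (E : Finset (ℕ × ℕ)) (blk : ℕ → ℕ) : ℕ → WitnessTree → Prop
  | _, nil => True
  | i, node e L R => e ∈ E ∧ EdgeMeetsBlock blk e i ∧ IsWitness E blk (blk e.1) L ∧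
      IsWitness E blk (blk e.2) R

/-- The vertices in the order in which they are resampled: the root comes last. -/
def vertices : WitnessTree → List ℕ
  | nil => []
  | node e L R => vertices R ++ (vertices L ++ [e.1, e.2])

open Classical in
/-- Insert `f` as an edge that is resampled before all others. -/
noncomputable def insert (blk : ℕ → ℕ) (f : ℕ × ℕ) : WitnessTree → WitnessTree
  | nil => node f nil nil
  | node e L R =>
      if EdgeMeetsBlock blk f (blk e.2) ∨ Meets blk f R then node e L (insert blk f R)
      else node e (insert blk f L) R

theorem insert_ne_nil (f : ℕ × ℕ) (τ : WitnessTree) : insert blk f τ ≠ nil := by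
  cases τ with
  | nil => simp [insert]
  | node e L R =>
    rw [insert]
    split_ifs <;> simp

theorem size_insert (f : ℕ × ℕ) (τ : WitnessTree) : (insert blk f τ).size = τ.size + 1 := by
  induction τ with
  | nil => rfl
  | node e L R ihL ihR =>
    rw [insert]
    split_ifs
    · simp only [size, ihR]; omega
    · simp only [size, ihL]; omega

theorem meets_insert {f g : ℕ × ℕ} (h : EdgesMeet blk g f) (τ : WitnessTree) :
    Meets blk g (insert blk f τ) := by
  induction τ with
  | nil => exact Or.inl h
  | node e L R ihL ihR =>
    rw [insert]
    split_ifs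
    · exact Or.inr (Or.inr ihR)
    · exact Or.inr (Or.inl ihL)

/-- The root meets block `i`, so an edge that meets `i` or the root has an end in one of the root's
two blocks. What cannot be attached on the right can therefore be attached on the left, and `insert`
keeps the tree a witness. -/
theorem Meets.left {f e : ℕ × ℕ} {i : ℕ} {L R : WitnessTree}
    (h : IsWitness E blk i (node e L R))
    (hf : EdgeMeetsBlock blk f i ∨ Meets blk f (node e L R))
    (hR : ¬ (EdgeMeetsBlock blk f (blk e.2) ∨ Meets blk f R)) :
    EdgeMeetsBlock blk f (blk e.1) ∨ Meets blk f L := by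
  have h2 := h.2.1
  simp only [Meets] at hf
  rcases hf with hf | hf | hf | hf
  · rcases EdgesMeet.of_block hf h2 with h' | h'
    · exact Or.inl h'
    · exact absurd (Or.inl h') hR
  · rcases hf with h' | h'
    · exact Or.inl h'
    · exact absurd (Or.inl h') hR
  · exact Or.inr hf
  · exact absurd (Or.inr hf) hR

theorem IsWitness.insert {f : ℕ × ℕ} (hfE : f ∈ E) {i : ℕ} {τ : WitnessTree}
    (h : IsWitness E blk i τ) (hf : EdgeMeetsBlock blk f i ∨ Meets blk f τ) :
    IsWitness E blk i (insert blk f τ) := by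
  induction τ generalizing i with
  | nil =>
    rcases hf with hf | hf
    · exact ⟨hfE, hf, trivial, trivial⟩
    · exact hf.elim
  | node e L R ihL ihR =>
    rw [WitnessTree.insert]
    split_ifs with hc
    · exact ⟨h.1, h.2.1, h.2.2.1, ihR h.2.2.2 hc⟩
    · exact ⟨h.1, h.2.1, ihL h.2.2.1 (Meets.left h hf hc), h.2.2.2⟩

/-- Both insertions must take the same branch at each node: if `f` goes right and `g` left, the
common right subtree contains `f`, hence meets `g`, and `g` would have gone right. The two
recursions thus run in parallel down to the same empty slot. -/
theorem insert_inj {f g : ℕ × ℕ} (hfg : EdgesMeet blk f g) (hgf : EdgesMeet blk g f)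
    {i j : ℕ} {τ θ : WitnessTree} (hτ : IsWitness E blk i τ) (hθ : IsWitness E blk j θ)
    (hf : EdgeMeetsBlock blk f i ∨ Meets blk f τ) (hg : EdgeMeetsBlock blk g j ∨ Meets blk g θ)
    (h : insert blk f τ = insert blk g θ) : f = g ∧ τ = θ := by
  induction τ generalizing i j θ with
  | nil =>
    have hs := congrArg size h
    rw [size_insert, size_insert] at hs
    cases θ with
    | nil => simpa [WitnessTree.insert] using h
    | node e L R => simp [size] at hs
  | node e L R ihL ihR =>
    cases θ with
    | nil =>
      have hs := congrArg size h
      rw [size_insert, size_insert] at hs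
      simp [size] at hs
    | node e' L' R' =>
      rw [WitnessTree.insert, WitnessTree.insert] at h
      split_ifs at h with hc hc' hc'
      · simp only [node.injEq] at h
        obtain ⟨rfl, rfl, h⟩ := h
        obtain ⟨h1, h2⟩ := ihR hτ.2.2.2 hθ.2.2.2 hc hc' h
        exact ⟨h1, by rw [h2]⟩
      · simp only [node.injEq] at h
        exact absurd (Or.inr (h.2.2 ▸ meets_insert hgf R)) hc'
      · simp only [node.injEq] at h
        exact absurd (Or.inr (h.2.2 ▸ meets_insert hfg R')) hc
      · simp only [node.injEq] at h
        obtain ⟨rfl, h, rfl⟩ := h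
        obtain ⟨h1, h2⟩ := ihL hτ.2.2.1 hθ.2.2.1 (Meets.left hτ hf hc) (Meets.left hθ hg hc') h
        exact ⟨h1, by rw [h2]⟩

theorem blk_ne_of_not_meets {f : ℕ × ℕ} {τ : WitnessTree} (h : ¬ Meets blk f τ) :
    ∀ v ∈ τ.vertices, blk f.1 ≠ blk v ∧ blk f.2 ≠ blk v := by
  induction τ with
  | nil => simp [vertices]
  | node e L R ihL ihR =>
    simp only [Meets, not_or, EdgesMeet, EdgeMeetsBlock] at h
    obtain ⟨⟨⟨h1, h2⟩, h3, h4⟩, hL, hR⟩ := h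
    intro v hv
    simp only [vertices, List.mem_append, List.mem_cons, List.not_mem_nil, or_false] at hv
    rcases hv with hv | hv | rfl | rfl
    · exact ihR hR v hv
    · exact ihL hL v hv
    · exact ⟨h1, h2⟩
    · exact ⟨h3, h4⟩

/-- The right subtree is listed first, so an insertion there already precedes everything. An
insertion on the left happens only if `f` does not meet the right subtree, and then `f` commutes
past it. -/
theorem listWeight_insert (f : ℕ × ℕ) (τ : WitnessTree) (t : List ℕ) :
    listWeight B blk ((insert blk f τ).vertices ++ t) =
      listWeight B blk (f.1 :: f.2 :: (τ.vertices ++ t)) := by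
  induction τ generalizing t with
  | nil => rfl
  | node e L R ihL ihR =>
    rw [insert]
    split_ifs with hc
    · simp only [vertices, List.append_assoc]
      rw [ihR]
    · simp only [vertices, List.append_assoc]
      rw [listWeight_append_congr _ (ihL _)]
      have hR := blk_ne_of_not_meets fun h => hc (Or.inr h)
      rw [listWeight_append_cons fun v hv => (hR v hv).1, listWeight_cons,
        listWeight_append_cons fun v hv => (hR v hv).2]
      rfl

theorem mem_vertices {P : ℕ → Prop} (hP : ∀ e ∈ E, P e.1 ∧ P e.2) {i : ℕ} {τ : WitnessTree}
    (h : IsWitness E blk i τ) : ∀ v ∈ τ.vertices, P v := by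
  induction τ generalizing i with
  | nil => simp [vertices]
  | node e L R ihL ihR =>
    intro v hv
    simp only [vertices, List.mem_append, List.mem_cons, List.not_mem_nil, or_false] at hv
    rcases hv with hv | hv | rfl | rfl
    · exact ihR h.2.2.2 v hv
    · exact ihL h.2.2.1 v hv
    · exact (hP e h.1).1
    · exact (hP e h.1).2

/-! ### Summing the weights of witness trees -/

/-- The product of the weights of the labels. -/
noncomputable def labelProd (w : ℕ × ℕ → ENNReal) : WitnessTree → ENNReal
  | nil => 1
  | node e L R => w e * (labelProd w L * labelProd w R)

theorem labelProd_eq (c : ENNReal) (q : ℕ → ENNReal) (τ : WitnessTree) :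
    labelProd (fun e => c * (q e.1 * q e.2)) τ = c ^ τ.size * (τ.vertices.map q).prod := by
  induction τ with
  | nil => simp [labelProd, size, vertices]
  | node e L R ihL ihR =>
    simp only [labelProd, ihL, ihR, size, vertices, List.map_append, List.prod_append,
      List.map_cons, List.prod_cons, List.map_nil, List.prod_nil]
    ring

open Classical in
/-- The weight of a witness tree of depth less than the first argument. -/
noncomputable def depthWeight (E : Finset (ℕ × ℕ)) (blk : ℕ → ℕ) (w : ℕ × ℕ → ENNReal) :
    ℕ → ℕ → WitnessTree → ENNReal
  | 0, _, _ => 0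
  | _ + 1, _, nil => 1
  | N + 1, i, node e L R =>
      if e ∈ E ∧ EdgeMeetsBlock blk e i then
        w e * (depthWeight E blk w N (blk e.1) L * depthWeight E blk w N (blk e.2) R)
      else 0

theorem labelProd_eq_depthWeight {w : ℕ × ℕ → ENNReal} {N i : ℕ} {τ : WitnessTree}
    (h : IsWitness E blk i τ) (hN : τ.size < N) :
    labelProd w τ = depthWeight E blk w N i τ := by
  induction τ generalizing N i with
  | nil =>
    obtain _ | N := N
    · omega
    · rfl
  | node e L R ihL ihR =>
    obtain _ | N := N
    · omega
    · simp only [size] at hN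
      rw [depthWeight, if_pos ⟨h.1, h.2.1⟩, labelProd, ihL (N := N) h.2.2.1 (by omega),
        ihR (N := N) h.2.2.2 (by omega)]

/-- A tree is empty or consists of its root and two subtrees. -/
def equivSum : Unit ⊕ ((ℕ × ℕ) × WitnessTree × WitnessTree) ≃ WitnessTree where
  toFun
    | .inl _ => nil
    | .inr (e, L, R) => node e L R
  invFun
    | nil => .inl ()
    | node e L R => .inr (e, L, R)
  left_inv := by rintro (_ | ⟨e, L, R⟩) <;> rfl
  right_inv := by rintro (_ | ⟨e, L, R⟩) <;> rfl

theorem tsum_eq (h : WitnessTree → ENNReal) :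
    ∑' τ, h τ = h nil + ∑' e, ∑' L, ∑' R, h (node e L R) := by
  rw [← equivSum.tsum_eq, Summable.tsum_sum ENNReal.summable ENNReal.summable,
    tsum_fintype, Finset.univ_unique, Finset.sum_singleton]
  simp only [ENNReal.tsum_prod']
  rfl

theorem tsum_depthWeight_succ (w : ℕ × ℕ → ENNReal) (N i : ℕ) [DecidablePred (EdgeMeetsBlock blk · i)] :
    ∑' τ, depthWeight E blk w (N + 1) i τ = 1 + ∑ e ∈ E.filter (EdgeMeetsBlock blk · i),
      w e * ((∑' τ, depthWeight E blk w N (blk e.1) τ) *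
        ∑' τ, depthWeight E blk w N (blk e.2) τ) := by
  rw [tsum_eq, depthWeight]
  congr 1
  rw [tsum_eq_sum (s := E.filter (EdgeMeetsBlock blk · i))]
  · refine Finset.sum_congr rfl fun e he => ?_
    simp only [depthWeight, if_pos (Finset.mem_filter.1 he), ENNReal.tsum_mul_left,
      ENNReal.tsum_mul_right]
  · intro e he
    simp only [depthWeight, if_neg (fun h => he (Finset.mem_filter.2 h)), tsum_zero]

/-- Truncation by depth makes the self-referential equation for the total weight an induction, and
`2` solves `t = 1 + t² / 4`. -/
theorem tsum_depthWeight_le {w : ℕ × ℕ → ENNReal} {l : ℕ}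
    [∀ i, DecidablePred (EdgeMeetsBlock blk · i)] (hE : ∀ e ∈ E, blk e.1 < l ∧ blk e.2 < l)
    (hw : ∀ i < l, ∑ e ∈ E.filter (EdgeMeetsBlock blk · i), w e ≤ 4⁻¹) (N : ℕ) :
    ∀ i < l, ∑' τ, depthWeight E blk w N i τ ≤ 1 + 1 := by
  induction N with
  | zero => simp [depthWeight]
  | succ N ih =>
    intro i hi
    rw [tsum_depthWeight_succ]
    refine add_le_add_right ?_ _
    calc _ ≤ ∑ e ∈ E.filter (EdgeMeetsBlock blk · i), w e * ((1 + 1) * (1 + 1)) := by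
          refine Finset.sum_le_sum fun e he => ?_
          have := hE e (Finset.mem_filter.1 he).1
          exact mul_le_mul_right (mul_le_mul' (ih _ this.1) (ih _ this.2)) _
      _ ≤ 4⁻¹ * ((1 + 1) * (1 + 1)) := by
          rw [← Finset.sum_mul]
          exact mul_le_mul_left (hw i hi) _
      _ = 1 := by
          rw [show ((1 : ENNReal) + 1) * (1 + 1) = 4 by norm_num]
          exact ENNReal.inv_mul_cancel (by norm_num) (by norm_num)

-- Any finite set of trees has bounded depth, so the truncated bound passes to the full sum. The
-- empty tree accounts for exactly `1` of the total `2`.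
open Classical in
theorem tsum_labelProd_le {w : ℕ × ℕ → ENNReal} {l : ℕ}
    (hE : ∀ e ∈ E, blk e.1 < l ∧ blk e.2 < l)
    (hw : ∀ i < l, ∑ e ∈ E.filter (EdgeMeetsBlock blk · i), w e ≤ 4⁻¹) {i : ℕ} (hi : i < l) :
    ∑' τ, (if τ ≠ nil ∧ IsWitness E blk i τ then labelProd w τ else 0) ≤ 1 := by
  have key : ∑' τ, (if IsWitness E blk i τ then labelProd w τ else 0) ≤ 1 + 1 := by
    refine ENNReal.summable.tsum_le_of_sum_le fun s => ?_
    refine le_trans ?_ (tsum_depthWeight_le hE hw (s.sup size + 1) i hi)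
    refine le_trans (Finset.sum_le_sum fun τ hτ => ?_) (ENNReal.sum_le_tsum s)
    split_ifs with h
    · exact (labelProd_eq_depthWeight h (Nat.lt_succ_of_le (Finset.le_sup hτ))).le
    · exact zero_le
  rw [tsum_eq] at key ⊢
  simp only [ne_eq, not_true_eq_false, false_and, if_false, zero_add, reduceCtorEq,
    not_false_eq_true, true_and]
  rw [if_pos (show IsWitness E blk i nil from trivial),
    show labelProd w nil = 1 from rfl] at key
  exact (ENNReal.add_le_add_iff_left ENNReal.one_ne_top).1 key

end WitnessTree

/-! ### The resampling potential -/

/-- The data of a resampling problem: blocks `B i` for `i < l` of sizes with inverses that sum, over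
the edges at each block, to at most `k / 4`. -/
structure IsResamplingInstance (B : ℕ → Finset ℕ) (blk : ℕ → ℕ) (E : Finset (ℕ × ℕ))
    (k l : ℕ) : Prop where
  block_nonempty : ∀ i < l, (B i).Nonempty
  mem_block : ∀ e ∈ E, e.1 ∈ B (blk e.1) ∧ e.2 ∈ B (blk e.2)
  blk_lt : ∀ e ∈ E, blk e.1 < l ∧ blk e.2 < l
  blk_ne : ∀ e ∈ E, blk e.1 ≠ blk e.2
  sum_le : ∀ i < l, ∀ [DecidablePred (EdgeMeetsBlock blk · i)],
    ∑ e ∈ E.filter (EdgeMeetsBlock blk · i), (k : ENNReal)⁻¹ *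
      (((B (blk e.1)).card : ENNReal)⁻¹ * ((B (blk e.2)).card : ENNReal)⁻¹) ≤ 4⁻¹

namespace WitnessTree

variable {B : ℕ → Finset ℕ} {blk : ℕ → ℕ} {E : Finset (ℕ × ℕ)} {k l : ℕ}

open Classical in
/-- The weight of a witness tree for the current representatives `x`. -/
noncomputable def weight (B : ℕ → Finset ℕ) (blk : ℕ → ℕ) (E : Finset (ℕ × ℕ)) (k : ℕ)
    (τ : WitnessTree) (x : ℕ → ℕ) : ENNReal :=
  if ∃ i, IsWitness E blk i τ then (k : ENNReal)⁻¹ ^ τ.size * listWeight B blk τ.vertices x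
  else 0

theorem weight_nil (x : ℕ → ℕ) : weight B blk E k nil x = 1 := by
  rw [weight, if_pos ⟨0, trivial⟩]
  simp [size, vertices, listWeight]

theorem weight_of_isWitness {i : ℕ} {τ : WitnessTree} (h : IsWitness E blk i τ) :
    weight B blk E k τ = fun x => (k : ENNReal)⁻¹ ^ τ.size * listWeight B blk τ.vertices x :=
  funext fun _ => if_pos ⟨i, h⟩

theorem weight_of_not_isWitness {τ : WitnessTree} (h : ¬ ∃ i, IsWitness E blk i τ) :
    weight B blk E k τ = fun _ => 0 :=
  funext fun _ => if_neg h

theorem exists_isWitness_and_meets {f : ℕ × ℕ} {τ : WitnessTree}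
    (h : ∃ i, IsWitness E blk i τ) (hf : τ = nil ∨ Meets blk f τ) :
    ∃ i, IsWitness E blk i τ ∧ (EdgeMeetsBlock blk f i ∨ Meets blk f τ) := by
  rcases hf with rfl | hf
  · exact ⟨blk f.1, trivial, Or.inl (Or.inl rfl)⟩
  · obtain ⟨i, hi⟩ := h
    exact ⟨i, hi, Or.inr hf⟩

/-- Since `f` is present in `x`, the requirement at its two ends holds, and only the averaging over
its blocks remains from the new node. The factor `k⁻¹` for choosing `f` pays for the extra node. -/
theorem mul_blockAvg_weight_eq_of_meets {f : ℕ × ℕ} (hfE : f ∈ E) (hne : blk f.1 ≠ blk f.2)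
    {x : ℕ → ℕ} (h1 : x (blk f.1) = f.1) (h2 : x (blk f.2) = f.2) {τ : WitnessTree}
    (h : ∃ i, IsWitness E blk i τ) (hf : τ = nil ∨ Meets blk f τ) :
    (k : ENNReal)⁻¹ * blockAvg B (blk f.1) (blockAvg B (blk f.2) (weight B blk E k τ)) x =
      weight B blk E k (insert blk f τ) x := by
  obtain ⟨i, hi, hf⟩ := exists_isWitness_and_meets h hf
  rw [weight_of_isWitness (hi.insert hfE hf), weight_of_isWitness hi, size_insert]
  have hl := listWeight_insert (B := B) (blk := blk) f τ []
  simp only [List.append_nil] at hl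
  simp only [hl, listWeight_cons]
  rw [resampleAt_resampleAt_of_eq hne h1 h2,
    show blockAvg B (blk f.2) _ = _ from funext fun y => blockAvg_mul _ _ _ y, blockAvg_mul]
  ring

theorem blockAvg_weight_of_not_meets {f : ℕ × ℕ} (hb1 : (B (blk f.1)).Nonempty)
    (hb2 : (B (blk f.2)).Nonempty) {τ : WitnessTree} (hf : ¬ Meets blk f τ) (x : ℕ → ℕ) :
    blockAvg B (blk f.1) (blockAvg B (blk f.2) (weight B blk E k τ)) x =
      weight B blk E k τ x := by
  by_cases h : ∃ i, IsWitness E blk i τ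
  · obtain ⟨i, hi⟩ := h
    have hv := blk_ne_of_not_meets hf
    rw [weight_of_isWitness hi,
      show blockAvg B (blk f.2) _ = _ from funext fun y => blockAvg_mul _ _ _ y, blockAvg_mul,
      blockAvg_listWeight hb2 fun v h => (hv v h).2, blockAvg_listWeight hb1 fun v h => (hv v h).1]
  · rw [weight_of_not_isWitness h, blockAvg_const hb2, blockAvg_const hb1]

/-- The total weight of all nonempty trees bounds the expected number of resamplings. -/
noncomputable def potential (B : ℕ → Finset ℕ) (blk : ℕ → ℕ) (E : Finset (ℕ × ℕ)) (k : ℕ)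
    (x : ℕ → ℕ) : ENNReal :=
  ∑' e, ∑' L, ∑' R, weight B blk E k (node e L R) x

theorem tsum_weight (x : ℕ → ℕ) :
    ∑' τ, weight B blk E k τ x = 1 + potential B blk E k x := by
  rw [tsum_eq, weight_nil, potential]

open Classical in
theorem potential_eq (x : ℕ → ℕ) :
    potential B blk E k x = ∑' τ, if τ ≠ nil then weight B blk E k τ x else 0 := by
  rw [tsum_eq]
  simp [potential]

/-- When `k` edges that pairwise meet are present, resampling a random one of them decreases the
potential by one in expectation. -/
theorem sum_blockAvg_potential_le (H : IsResamplingInstance B blk E k l) {x : ℕ → ℕ}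
    (f : Fin k → ℕ × ℕ) (hinj : Function.Injective f) (hfE : ∀ r, f r ∈ E)
    (hx : ∀ r, x (blk (f r).1) = (f r).1 ∧ x (blk (f r).2) = (f r).2)
    (hmeet : ∀ r s, EdgesMeet blk (f r) (f s)) :
    ∑ r, (k : ENNReal)⁻¹ * blockAvg B (blk (f r).1)
      (blockAvg B (blk (f r).2) (fun y => 1 + potential B blk E k y)) x ≤
      potential B blk E k x := by
  classical
  set w := weight B blk E k with hw
  -- `S` holds the pairs to which an insertion applies. `A` contains the image of these insertions;
  -- the trees outside `A` remain to pay for the pairs without interaction.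
  let S : Set (Fin k × WitnessTree) :=
    {p | (∃ i, IsWitness E blk i p.2) ∧ (p.2 = nil ∨ Meets blk (f p.1) p.2)}
  let A : Set WitnessTree := {τ | τ ≠ nil ∧ ∀ r, Meets blk (f r) τ}
  have step1 : ∀ (r : Fin k) (τ : WitnessTree),
      (k : ENNReal)⁻¹ * blockAvg B (blk (f r).1) (blockAvg B (blk (f r).2) (w τ)) x ≤
        S.indicator (fun p => w (insert blk (f p.1) p.2) x) (r, τ) +
          (if τ ≠ nil ∧ τ ∉ A then (k : ENNReal)⁻¹ * w τ x else 0) := by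
    intro r τ
    have hb := H.blk_lt _ (hfE r)
    by_cases hm : τ = nil ∨ Meets blk (f r) τ
    · by_cases hwit : ∃ i, IsWitness E blk i τ
      · rw [Set.indicator_of_mem (show (r, τ) ∈ S from ⟨hwit, hm⟩),
          mul_blockAvg_weight_eq_of_meets (hfE r) (H.blk_ne _ (hfE r)) (hx r).1 (hx r).2 hwit hm]
        exact le_self_add
      · rw [hw, weight_of_not_isWitness hwit, blockAvg_const (H.block_nonempty _ hb.2),
          blockAvg_const (H.block_nonempty _ hb.1), mul_zero]
        exact zero_le
    · rw [not_or] at hm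
      rw [if_pos ⟨hm.1, fun hA => hm.2 (hA.2 r)⟩, hw, blockAvg_weight_of_not_meets
        (H.block_nonempty _ hb.1) (H.block_nonempty _ hb.2) hm.2]
      exact le_add_self
  have step2 : ∑' p : Fin k × WitnessTree, S.indicator (fun p => w (insert blk (f p.1) p.2) x) p ≤
      ∑' τ, A.indicator (fun τ => w τ x) τ := by
    rw [← tsum_subtype S (fun p => w (insert blk (f p.1) p.2) x)]
    have hS : Function.Injective (fun p : S => insert blk (f p.1.1) p.1.2) := by
      rintro ⟨⟨r, τ⟩, h1, h2⟩ ⟨⟨s, θ⟩, h3, h4⟩ h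
      obtain ⟨i, hi, h2⟩ := exists_isWitness_and_meets h1 h2
      obtain ⟨j, hj, h4⟩ := exists_isWitness_and_meets h3 h4
      obtain ⟨hrs, rfl⟩ := insert_inj (hmeet r s) (hmeet s r) hi hj h2 h4 h
      obtain rfl := hinj hrs
      rfl
    refine le_trans (le_of_eq ?_) (ENNReal.tsum_comp_le_tsum_of_injective hS _)
    refine tsum_congr fun p => ?_
    rw [Set.indicator_of_mem]
    exact ⟨insert_ne_nil _ _, fun r => meets_insert (hmeet _ _) _⟩
  -- Each such tree is left unchanged by at most `k` choices, of probability `k⁻¹` each.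
  have step3 : ∑' p : Fin k × WitnessTree,
      (if p.2 ≠ nil ∧ p.2 ∉ A then (k : ENNReal)⁻¹ * w p.2 x else 0) ≤
      ∑' τ, if τ ≠ nil ∧ τ ∉ A then w τ x else 0 := by
    rw [ENNReal.tsum_prod', ENNReal.tsum_comm]
    refine ENNReal.tsum_le_tsum fun τ => ?_
    split_ifs
    · simp only [tsum_fintype, Finset.sum_const, Finset.card_univ, Fintype.card_fin, nsmul_eq_mul,
        ← mul_assoc]
      exact mul_le_of_le_one_left' (ENNReal.mul_inv_le_one _)
    · simp
  calc ∑ r, (k : ENNReal)⁻¹ * blockAvg B (blk (f r).1)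
        (blockAvg B (blk (f r).2) (fun y => 1 + potential B blk E k y)) x
      = ∑' p : Fin k × WitnessTree, (k : ENNReal)⁻¹ *
          blockAvg B (blk (f p.1).1) (blockAvg B (blk (f p.1).2) (w p.2)) x := by
        rw [ENNReal.tsum_prod', tsum_fintype]
        refine Finset.sum_congr rfl fun r _ => ?_
        simp only [← tsum_weight, ENNReal.tsum_mul_left]
        rw [show blockAvg B (blk (f r).2) _ = _ from funext fun y => blockAvg_tsum _ _ y,
          blockAvg_tsum]
    _ ≤ (∑' τ, A.indicator (fun τ => w τ x) τ) + ∑' τ, if τ ≠ nil ∧ τ ∉ A then w τ x else 0 := by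
        refine le_trans (ENNReal.tsum_le_tsum fun p => step1 p.1 p.2) ?_
        rw [ENNReal.tsum_add]
        exact add_le_add step2 step3
    _ = potential B blk E k x := by
        rw [← ENNReal.tsum_add, potential_eq]
        refine tsum_congr fun τ => ?_
        by_cases hn : τ = nil
        · rw [Set.indicator_of_notMem fun h => h.1 hn]
          simp [hn]
        · by_cases hA : τ ∈ A
          · simp [hA, hn, hw]
          · simp [hA, hn, hw]

/-- On average over all representatives, the potential is at most the number of blocks. -/
theorem blocksAvg_potential_le (H : IsResamplingInstance B blk E k l) (x : ℕ → ℕ) :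
    blocksAvg B l 0 (potential B blk E k) x ≤ l := by
  classical
  set w : ℕ × ℕ → ENNReal := fun e => (k : ENNReal)⁻¹ *
      (((B (blk e.1)).card : ENNReal)⁻¹ * ((B (blk e.2)).card : ENNReal)⁻¹) with hw
  rw [show potential B blk E k = _ from funext potential_eq, blocksAvg_tsum]
  calc ∑' τ, blocksAvg B l 0 (fun x => if τ ≠ nil then weight B blk E k τ x else 0) x
      ≤ ∑' τ, ∑ i ∈ Finset.range l,
          if τ ≠ nil ∧ IsWitness E blk i τ then labelProd w τ else 0 := by
        refine ENNReal.tsum_le_tsum fun τ => ?_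
        have h0 : blocksAvg B l 0 (fun _ => 0) x = 0 := by
          rw [blocksAvg_const fun i _ h => H.block_nonempty i (by omega)]
        by_cases hn : τ = nil
        · simp [hn, h0]
        simp only [ne_eq, hn, not_false_eq_true, if_true, true_and]
        by_cases hτ : ∃ i, IsWitness E blk i τ
        · obtain ⟨i, hi⟩ := hτ
          -- The witnessed block need not be below `l`, but the root may equally be seen from the
          -- block of its own first end.
          have hil : ∃ j < l, IsWitness E blk j τ := by
            cases τ with
            | nil => exact absurd rfl hn
            | node e L R => exact ⟨blk e.1, (H.blk_lt e hi.1).1, hi.1, Or.inl rfl, hi.2.2⟩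
          obtain ⟨j, hj, hjτ⟩ := hil
          refine le_trans (le_of_eq ?_)
            (Finset.single_le_sum (fun _ _ => zero_le) (Finset.mem_range.2 hj))
          rw [if_pos hjτ, weight_of_isWitness hi, blocksAvg_mul,
            blocksAvg_listWeight H.block_nonempty, hw,
            labelProd_eq _ fun u => ((B (blk u)).card : ENNReal)⁻¹]
          exact mem_vertices (P := fun u => u ∈ B (blk u) ∧ blk u < l) (fun e he =>
            ⟨⟨(H.mem_block e he).1, (H.blk_lt e he).1⟩, (H.mem_block e he).2, (H.blk_lt e he).2⟩) hi
        · rw [weight_of_not_isWitness hτ, h0]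
          exact zero_le
    _ = ∑ i ∈ Finset.range l, ∑' τ,
          if τ ≠ nil ∧ IsWitness E blk i τ then labelProd w τ else 0 :=
        Summable.tsum_finsetSum fun _ _ => ENNReal.summable
    _ ≤ ∑ i ∈ Finset.range l, 1 := Finset.sum_le_sum fun i hi =>
        tsum_labelProd_le H.blk_lt (fun j hj => H.sum_le j hj) (Finset.mem_range.1 hi)
    _ = l := by simp

end WitnessTree

/-! ### The resampling program -/

theorem Store.write_self (σ : Store) (a i x : ℕ) :
    σ.write a i x a = Function.update (σ a) i x := by
  simp [Store.write]

theorem Store.write_of_ne (σ : Store) {a b : ℕ} (h : b ≠ a) (i x : ℕ) :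
    σ.write a i x b = σ b := by
  simp [Store.write, h]

theorem Store.write_write (σ : Store) (a i x y : ℕ) :
    (σ.write a i x).write a i y = σ.write a i y := by
  simp [Store.write]

/-- The vertices below `n` in block `i`. -/
def blockSet (n : ℕ) (blk : ℕ → ℕ) (i : ℕ) : Finset ℕ :=
  (Finset.range n).filter (fun v => blk v = i)

theorem mem_blockSet {n : ℕ} {blk : ℕ → ℕ} {i v : ℕ} :
    v ∈ blockSet n blk i ↔ v < n ∧ blk v = i := by
  simp [blockSet]

namespace Resampling

/-- The variable stored in cell `0` of array `a`. -/
abbrev var (a : ℕ) : Expr := .cell a (.lit 0)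

/-- The representative of block `e`. -/
abbrev rep (e : Expr) : Expr := .cell 3 e

/-- The entry of the adjacency matrix for the representatives of two blocks. -/
abbrev adjEntry (e f : Expr) : Expr := .cell 2 (.add (.cell 4 (rep e)) (rep f))

/-- Nonzero if and only if the two expressions differ. -/
abbrev neq (e f : Expr) : Expr := .add (.sub e f) (.sub f e)

/-- Set the representative of the block in variable `a` to a random vertex. -/
def drawRep (a : ℕ) : Cmd := .draw 3 (var a) (.sub (var 0) (.lit 1))

/-- Resample the representative of the block in variable `a`. -/
def sample (a : ℕ) : Cmd :=
  .seq (drawRep a) (.loop (neq (.cell 1 (rep (var a))) (var a)) (drawRep a))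

/-- Compute the offsets of the rows of the adjacency matrix in array `4`. -/
def rows : Cmd :=
  .loop (.sub (var 0) (var 11)) (.seq
    (.assign 4 (.add (var 11) (.lit 1)) (.add (.cell 4 (var 11)) (var 0)))
    (.assign 11 (.lit 0) (.add (var 11) (.lit 1))))

/-- Sample the representatives of all blocks. -/
def sampleAll : Cmd :=
  .loop (.sub (.cell 0 (.lit 1)) (var 5)) (.seq (sample 5)
    (.assign 5 (.lit 0) (.add (var 5) (.lit 1))))

/-- Resample the blocks in variables `9` and `10`, and restart the search. -/
def resample : Cmd :=
  .seq (sample 9) (.seq (sample 10) (.seq (.assign 5 (.lit 0) (.lit 0))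
    (.seq (.assign 6 (.lit 0) (.lit 0)) (.assign 7 (.lit 0) (.lit 0)))))

/-- Put a random one among the first `κ + 1` of the pairs of blocks `(i, j)`, `(j, m)`, `(m, i)` in
variables `9` and `10`, and resample these blocks. -/
def fix (κ : ℕ) : Cmd :=
  .seq (.draw 8 (.lit 0) (.lit κ)) (.seq
    (.branch (var 8)
      (.branch (.sub (var 8) (.lit 1))
        (.seq (.assign 9 (.lit 0) (var 7)) (.assign 10 (.lit 0) (var 5)))
        (.seq (.assign 9 (.lit 0) (var 6)) (.assign 10 (.lit 0) (var 7))))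
      (.seq (.assign 9 (.lit 0) (var 5)) (.assign 10 (.lit 0) (var 6))))
    resample)

/-- Move to the next triple of blocks. -/
def advance : Cmd :=
  .seq (.assign 7 (.lit 0) (.add (var 7) (.lit 1)))
    (.branch (.sub (.cell 0 (.lit 1)) (var 7)) .nop
      (.seq (.assign 7 (.lit 0) (.lit 0)) (.seq (.assign 6 (.lit 0) (.add (var 6) (.lit 1)))
        (.branch (.sub (.cell 0 (.lit 1)) (var 6)) .nop
          (.seq (.assign 6 (.lit 0) (.lit 0)) (.assign 5 (.lit 0) (.add (var 5) (.lit 1))))))))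

/-- Search for a triple of blocks that passes the test, and resample it. -/
def search (κ : ℕ) (test : Expr) : Cmd :=
  .loop (.sub (.cell 0 (.lit 1)) (var 5)) (.branch test (fix κ) advance)

/-- The resampling algorithm. -/
def program (κ : ℕ) (test : Expr) : Cmd :=
  .seq rows (.seq sampleAll (.seq (.assign 5 (.lit 0) (.lit 0)) (search κ test)))

/-! ### Invariants and expected costs of the subroutines -/

/-- The memory contains the input. -/
structure Loaded (n l : ℕ) (blk adj : ℕ → ℕ) (σ : Store) : Prop where
  size : σ 0 0 = n
  blocks : σ 0 1 = l
  block : σ 1 = blk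
  matrix : σ 2 = adj

/-- The memory contains the input, the row offsets and representatives of the first `s` blocks. -/
structure Ready (n l : ℕ) (blk adj : ℕ → ℕ) (s : ℕ) (σ : Store) : Prop
    extends Loaded n l blk adj σ where
  row : ∀ v < n, σ 4 v = v * n
  mem : ∀ i < s, σ 3 i ∈ blockSet n blk i

variable {n l : ℕ} {blk adj : ℕ → ℕ}

theorem Loaded.write {σ : Store} (h : Loaded n l blk adj σ) {a : ℕ} (ha : 3 ≤ a) (i x : ℕ) :
    Loaded n l blk adj (σ.write a i x) := by
  obtain ⟨h1, h2, h3, h4⟩ := h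
  constructor <;> rwa [Store.write_of_ne _ (by omega)]

theorem Ready.write {σ : Store} {s : ℕ} (h : Ready n l blk adj s σ) {a : ℕ} (ha : 5 ≤ a)
    (i x : ℕ) : Ready n l blk adj s (σ.write a i x) := by
  refine ⟨h.toLoaded.write (by omega) i x, ?_, ?_⟩
  · rw [Store.write_of_ne _ (by omega)]
    exact h.row
  · rw [Store.write_of_ne _ (by omega)]
    exact h.mem

theorem Ready.write_rep {σ : Store} {s t : ℕ} (h : Ready n l blk adj s σ) {p a : ℕ}
    (ha : a ∈ blockSet n blk p) (hst : ∀ i < t, i < s ∨ i = p) :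
    Ready n l blk adj t (σ.write 3 p a) := by
  refine ⟨h.toLoaded.write le_rfl p a, ?_, ?_⟩
  · rw [Store.write_of_ne _ (by omega)]
    exact h.row
  · intro i hi
    rw [Store.write_self]
    by_cases hip : i = p
    · subst hip
      rwa [Function.update_self]
    · rw [Function.update_of_ne hip]
      exact h.mem i ((hst i hi).resolve_right hip)

/-- The expected cost of rejection sampling from a block. -/
theorem rejection_le {p : ℕ} (hp : (blockSet n blk p).Nonempty) (h : ℕ → ENNReal) :
    2 + ∑ v ∈ Finset.range n, (n : ENNReal)⁻¹ * (if blk v = p then 1 + h v else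
      (2 * n + 1 : ENNReal) + ((blockSet n blk p).card : ENNReal)⁻¹ * ∑ v ∈ blockSet n blk p, h v) ≤
    (2 * n + 1 : ENNReal) + ((blockSet n blk p).card : ENNReal)⁻¹ *
      ∑ v ∈ blockSet n blk p, h v := by
  set b := (blockSet n blk p).card with hb
  set A := (b : ENNReal)⁻¹ * ∑ v ∈ blockSet n blk p, h v with hA
  set X : ENNReal := (2 * n + 1 : ENNReal) + A with hX
  have hb1 : 1 ≤ b := hp.card_pos
  have hb0 : (b : ENNReal) ≠ 0 := by simp; omega
  have hn1 : 1 ≤ n := by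
    obtain ⟨v, hv⟩ := hp
    have := (mem_blockSet.1 hv).1
    omega
  have hn0 : (n : ENNReal) ≠ 0 := by simp; omega
  have hsum : ∑ v ∈ blockSet n blk p, h v = b * A := by
    rw [hA, ← mul_assoc, ENNReal.mul_inv_cancel hb0 (ENNReal.natCast_ne_top _), one_mul]
  obtain ⟨c, hc⟩ : ∃ c, ((Finset.range n).filter (fun v => ¬ blk v = p)).card = c := ⟨_, rfl⟩
  have hbc : b + c = n := by
    rw [hb, ← hc, blockSet, Finset.card_filter_add_card_filter_not, Finset.card_range]
  rw [← Finset.mul_sum, Finset.sum_ite, Finset.sum_const, hc, Finset.sum_add_distrib,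
    show Finset.filter (fun v => blk v = p) (Finset.range n) = blockSet n blk p from rfl,
    hsum, Finset.sum_const, ← hb]
  simp only [nsmul_eq_mul, mul_one]
  -- After clearing the denominator `n`, with `b` accepted and `c` rejected draws, everything
  -- cancels except `2n + b ≤ b (2n + 1)`, which holds since `b ≥ 1`.
  have h1 : (2 * n : ENNReal) + (b + b * A + c * X) ≤ n * X := by
    calc (2 * n : ENNReal) + (b + b * A + c * X) = ((2 * n + b : ℕ) : ENNReal) + (b * A + c * X) := by
          push_cast; ring
      _ ≤ ((b * (2 * n + 1) : ℕ) : ENNReal) + (b * A + c * X) := by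
          refine add_le_add_left (Nat.cast_le.2 ?_) _
          nlinarith
      _ = n * X := by
          rw [← hbc, hX]; push_cast; rw [← hbc]; push_cast; ring
  calc (2 : ENNReal) + (n : ENNReal)⁻¹ * (b + b * A + c * X)
      = (n : ENNReal)⁻¹ * (2 * n + (b + b * A + c * X)) := by
        rw [mul_add _ (2 * (n : ENNReal)), mul_comm 2 (n : ENNReal),
          ← mul_assoc _ (n : ENNReal) 2,
          ENNReal.inv_mul_cancel hn0 (ENNReal.natCast_ne_top _), one_mul]
    _ ≤ (n : ENNReal)⁻¹ * (n * X) := mul_le_mul_right h1 _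
    _ = X := by
        rw [← mul_assoc, ENNReal.inv_mul_cancel hn0 (ENNReal.natCast_ne_top _), one_mul]

theorem ert_drawRep {σ : Store} (hσ : Loaded n l blk adj σ) {a : ℕ} (hn : 0 < n)
    (g : Store → ENNReal) : (drawRep a).ert g σ =
      1 + ∑ v ∈ Finset.range n, (n : ENNReal)⁻¹ * g (σ.write 3 (σ a 0) v) := by
  obtain ⟨n, rfl⟩ : ∃ n', n = n' + 1 := ⟨n - 1, by omega⟩
  simp [drawRep, Cmd.ert, Expr.eval, hσ.size]

theorem ert_sample_le {σ : Store} (hσ : Loaded n l blk adj σ) {a : ℕ} (ha : 3 < a)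
    (hB : (blockSet n blk (σ a 0)).Nonempty) {g : Store → ENNReal} {h : (ℕ → ℕ) → ENNReal}
    (hg : ∀ v ∈ blockSet n blk (σ a 0),
      g (σ.write 3 (σ a 0) v) ≤ h (Function.update (σ 3) (σ a 0) v)) :
    (sample a).ert g σ ≤
      ((2 * n + 1 : ℕ) : ENNReal) + blockAvg (blockSet n blk) (σ a 0) h (σ 3) := by
  set p := σ a 0 with hp
  have hn : 0 < n := by
    obtain ⟨v, hv⟩ := hB
    have := (mem_blockSet.1 hv).1
    omega
  have hrej := rejection_le hB (fun v => h (Function.update (σ 3) p v))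
  set X : ENNReal := (2 * n + 1 : ENNReal) + ((blockSet n blk p).card : ENNReal)⁻¹ *
    ∑ v ∈ blockSet n blk p, h (Function.update (σ 3) p v) with hX
  have hpw : ∀ v, σ.write 3 p v a 0 = p := fun v => by rw [Store.write_of_ne _ (by omega)]
  have hval : ∀ v < n, (neq (.cell 1 (rep (var a))) (var a)).eval (σ.write 3 p v) =
      (blk v - p) + (p - blk v) := by
    intro v _
    have h1 : σ.write 3 p v 1 = blk := (hσ.write le_rfl p v).block
    simp [Expr.eval, hpw, h1, Store.write_self]
  have hloop : ∀ v < n, (Cmd.loop (neq (.cell 1 (rep (var a))) (var a)) (drawRep a)).ert g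
      (σ.write 3 p v) ≤ if blk v = p then 1 + h (Function.update (σ 3) p v) else X := by
    intro v hv
    -- During rejection the memory differs from `σ` only in the last draw, so a two-valued bound
    -- suffices: one final test on acceptance, the fixed cost `X` otherwise.
    refine le_trans (Cmd.ert_loop_le_of_inv (P := fun ρ => ∃ v < n, ρ = σ.write 3 p v)
      (I := fun ρ => if blk (ρ 3 p) = p then 1 + h (ρ 3) else X) ?_ ?_ ⟨v, hv, rfl⟩) ?_
    · rintro ρ ⟨w, hw, rfl⟩ h0
      rw [hval w hw] at h0
      have hwp : blk w = p := by omega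
      simp only [Store.write_self, Function.update_self, hwp, if_true]
      exact add_le_add_right (hg w (mem_blockSet.2 ⟨hw, hwp⟩)) _
    · rintro ρ J hJ ⟨w, hw, rfl⟩ h0
      rw [hval w hw] at h0
      have hwp : blk w ≠ p := by omega
      simp only [Store.write_self, Function.update_self, hwp, if_false]
      rw [ert_drawRep (hσ.write le_rfl p w) hn, hpw, ← add_assoc, one_add_one_eq_two]
      refine le_trans (add_le_add_right (Finset.sum_le_sum fun v hv => ?_) _) hrej
      rw [Store.write_write, hJ _ ⟨v, Finset.mem_range.1 hv, rfl⟩]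
      simp only [Store.write_self, Function.update_self]
      exact le_rfl
    · simp [Store.write_self]
  rw [sample, Cmd.ert, ert_drawRep hσ hn, ← add_assoc, one_add_one_eq_two]
  refine le_trans (add_le_add_right (Finset.sum_le_sum fun v hv =>
    mul_le_mul_right (hloop v (Finset.mem_range.1 hv)) _) _) (hrej.trans ?_)
  push_cast
  exact le_rfl

theorem blockAvg_const_add {B : ℕ → Finset ℕ} {i : ℕ} (hi : (B i).Nonempty) (c : ENNReal)
    (h : (ℕ → ℕ) → ENNReal) (x : ℕ → ℕ) :
    blockAvg B i (fun y => c + h y) x = c + blockAvg B i h x := by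
  rw [blockAvg_add, blockAvg_const hi]

theorem blocksAvg_const_add {B : ℕ → Finset ℕ} {c s : ℕ}
    (hB : ∀ i, s ≤ i → i < s + c → (B i).Nonempty) (a : ENNReal) (g : (ℕ → ℕ) → ENNReal) :
    blocksAvg B c s (fun y => a + g y) = fun y => a + blocksAvg B c s g y := by
  induction c generalizing s with
  | zero => rfl
  | succ c ih =>
    funext x
    rw [blocksAvg, ih fun i h h' => hB i (by omega) (by omega),
      blockAvg_const_add (hB s le_rfl (by omega)), blocksAvg]

theorem natCast_add_le {a b : ℕ} (h : a ≤ b) (X : ENNReal) : (a : ENNReal) + X ≤ b + X :=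
  add_le_add_left (Nat.cast_le.2 h) _

theorem ert_rows_le {σ : Store} (hσ : Loaded n l blk adj σ) (h4 : σ 4 0 = 0) (h11 : σ 11 0 = 0)
    {g : Store → ENNReal} {G : ENNReal}
    (hg : ∀ τ, Ready n l blk adj 0 τ → (∀ a, 5 ≤ a → a ≠ 11 → τ a = σ a) → g τ ≤ G) :
    rows.ert g σ ≤ ((1 + 4 * n : ℕ) : ENNReal) + G := by
  refine le_trans (Cmd.ert_loop_le_of_inv
    (P := fun ρ => Loaded n l blk adj ρ ∧ ρ 11 0 ≤ n ∧ (∀ v ≤ ρ 11 0, ρ 4 v = v * n) ∧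
      ∀ a, 5 ≤ a → a ≠ 11 → ρ a = σ a)
    (I := fun ρ => ((1 + 4 * (n - ρ 11 0) : ℕ) : ENNReal) + G) ?_ ?_ ⟨hσ, ?_, ?_, ?_⟩) ?_
  · rintro ρ ⟨hρ, h1, h2, h3⟩ h0
    simp only [Expr.eval, hρ.size] at h0
    have := hg ρ ⟨hρ, fun v hv => h2 v (by omega), by simp⟩ h3
    calc 1 + g ρ ≤ ((1 : ℕ) : ENNReal) + G := by simpa using add_le_add_right this 1
      _ ≤ _ := natCast_add_le (by omega) _
  · rintro ρ J hJ ⟨hρ, h1, h2, h3⟩ h0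
    simp only [Expr.eval, hρ.size] at h0
    simp only [Cmd.ert, Expr.eval, hρ.size]
    have hP : ∀ τ, τ = (ρ.write 4 (ρ 11 0 + 1) (ρ 4 (ρ 11 0) + n)).write 11 0 (ρ 11 0 + 1) →
        J τ = ((1 + 4 * (n - (ρ 11 0 + 1)) : ℕ) : ENNReal) + G := by
      rintro τ rfl
      have h11 : ((ρ.write 4 (ρ 11 0 + 1) (ρ 4 (ρ 11 0) + n)).write 11 0 (ρ 11 0 + 1)) 11 0 =
        ρ 11 0 + 1 := by simp [Store.write_self]
      rw [hJ _ ⟨(hρ.write (by omega) _ _).write (by omega) _ _, by omega, ?_, ?_⟩, h11]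
      · rw [h11]
        intro v hv
        rw [Store.write_of_ne _ (by omega), Store.write_self]
        by_cases hv' : v = ρ 11 0 + 1
        · subst hv'
          rw [Function.update_self, h2 _ le_rfl]
          ring
        · rw [Function.update_of_ne hv', h2 v (by omega)]
      · intro a ha ha'
        rw [Store.write_of_ne _ ha', Store.write_of_ne _ (by omega)]
        exact h3 a ha ha'
    have hsim : (ρ.write 4 (ρ 11 0 + 1) (ρ 4 (ρ 11 0) + n)) 11 0 = ρ 11 0 := by
      rw [Store.write_of_ne _ (by omega)]
    rw [hsim, hP _ rfl]
    calc _ = ((4 + (1 + 4 * (n - (ρ 11 0 + 1))) : ℕ) : ENNReal) + G := by push_cast; ring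
      _ ≤ _ := natCast_add_le (by omega) _
  · omega
  · intro v hv
    obtain rfl : v = 0 := by omega
    simpa using h4
  · exact fun _ _ _ => rfl
  · exact natCast_add_le (by omega) _

/-- The loop bound averages `F` over the blocks not yet drawn; each iteration replaces one level of
this average by an actual draw. -/
theorem ert_sampleAll_le (hB : ∀ i < l, (blockSet n blk i).Nonempty) {σ : Store}
    (hσ : Ready n l blk adj 0 σ) (h5 : σ 5 0 = 0) {g : Store → ENNReal}
    {F : (ℕ → ℕ) → ENNReal}
    (hg : ∀ τ, Ready n l blk adj l τ → τ 6 = σ 6 → τ 7 = σ 7 → g τ ≤ F (τ 3)) :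
    sampleAll.ert g σ ≤ ((1 + (2 * n + 4) * l : ℕ) : ENNReal) +
      blocksAvg (blockSet n blk) l 0 F (σ 3) := by
  refine le_trans (Cmd.ert_loop_le_of_inv
    (P := fun ρ => Ready n l blk adj (ρ 5 0) ρ ∧ ρ 5 0 ≤ l ∧ ρ 6 = σ 6 ∧ ρ 7 = σ 7)
    (I := fun ρ => ((1 + (2 * n + 4) * (l - ρ 5 0) : ℕ) : ENNReal) +
      blocksAvg (blockSet n blk) (l - ρ 5 0) (ρ 5 0) F (ρ 3)) ?_ ?_ ⟨?_, ?_, rfl, rfl⟩) ?_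
  · rintro ρ ⟨hρ, h1, h6, h7⟩ h0
    simp only [Expr.eval, hρ.blocks] at h0
    have hl : ρ 5 0 = l := by omega
    rw [hl] at hρ ⊢
    simpa [blocksAvg] using hg ρ hρ h6 h7
  · rintro ρ J hJ ⟨hρ, h1, h6, h7⟩ h0
    simp only [Expr.eval, hρ.blocks] at h0
    obtain ⟨c, hc⟩ : ∃ c, l - ρ 5 0 = c + 1 := ⟨l - ρ 5 0 - 1, by omega⟩
    have hb := hB (ρ 5 0) (by omega)
    have hs := ert_sample_le (a := 5) hρ.toLoaded (by omega) hb
      (g := (Cmd.assign 5 (.lit 0) (.add (var 5) (.lit 1))).ert J)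
      (h := fun y => ((2 + (2 * n + 4) * c : ℕ) : ENNReal) +
        blocksAvg (blockSet n blk) c (ρ 5 0 + 1) F y) (by
          intro v hv
          simp only [Cmd.ert, Expr.eval]
          rw [show ρ.write 3 (ρ 5 0) v 5 0 = ρ 5 0 by rw [Store.write_of_ne _ (by omega)]]
          have hτ5 : (ρ.write 3 (ρ 5 0) v).write 5 0 (ρ 5 0 + 1) 5 0 = ρ 5 0 + 1 := by
            simp [Store.write_self]
          have hτ3 : (ρ.write 3 (ρ 5 0) v).write 5 0 (ρ 5 0 + 1) 3 =
              Function.update (ρ 3) (ρ 5 0) v := by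
            rw [Store.write_of_ne _ (by omega), Store.write_self]
          rw [hJ, hτ5, hτ3, show l - (ρ 5 0 + 1) = c by omega]
          · push_cast
            apply le_of_eq
            ring
          · rw [hτ5]
            refine ⟨(hρ.write_rep hv fun i hi => by omega).write (by omega) _ _, by omega, ?_, ?_⟩
            · rw [Store.write_of_ne _ (by omega), Store.write_of_ne _ (by omega), h6]
            · rw [Store.write_of_ne _ (by omega), Store.write_of_ne _ (by omega), h7])
    rw [blockAvg_const_add hb] at hs
    rw [Cmd.ert]
    refine le_trans (add_le_add_right (add_le_add_right hs _) _) ?_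
    rw [hc, blocksAvg]
    refine le_trans (le_of_eq ?_) (natCast_add_le
      (a := 2 + (2 * n + 1) + (2 + (2 * n + 4) * c)) (by ring_nf; omega) _)
    push_cast
    ring
  · rw [h5]
    exact hσ
  · omega
  · simp [h5]

theorem ert_resample_le (hB : ∀ i < l, (blockSet n blk i).Nonempty) {σ : Store}
    (hσ : Ready n l blk adj l σ) (h9 : σ 9 0 < l) (h10 : σ 10 0 < l) {J : Store → ENNReal}
    {h : (ℕ → ℕ) → ENNReal} (hJ : ∀ τ, Ready n l blk adj l τ → τ 5 0 = 0 → τ 6 0 = 0 →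
      τ 7 0 = 0 → J τ ≤ h (τ 3)) :
    resample.ert J σ ≤ ((4 * n + 20 : ℕ) : ENNReal) +
      blockAvg (blockSet n blk) (σ 9 0) (blockAvg (blockSet n blk) (σ 10 0) h) (σ 3) := by
  set reset : Cmd := .seq (.assign 5 (.lit 0) (.lit 0))
    (.seq (.assign 6 (.lit 0) (.lit 0)) (.assign 7 (.lit 0) (.lit 0))) with hreset
  have h1 : ∀ τ, Ready n l blk adj l τ → reset.ert J τ ≤ 5 + h (τ 3) := by
    intro τ hτ
    rw [hreset]
    simp only [Cmd.ert, Expr.eval]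
    set τ' := ((τ.write 5 0 0).write 6 0 0).write 7 0 0 with hτ'
    have h3 : τ' 3 = τ 3 := by simp [hτ', Store.write_of_ne]
    have := hJ τ' (((hτ.write (by omega) _ _).write (by omega) _ _).write (by omega) _ _)
      (by simp [hτ', Store.write_of_ne, Store.write_self])
      (by simp [hτ', Store.write_of_ne, Store.write_self])
      (by simp [hτ', Store.write_self])
    rw [h3] at this
    calc _ = 5 + J τ' := by ring
      _ ≤ _ := add_le_add_right this _
  have h2 : ∀ v ∈ blockSet n blk (σ 9 0),
      (Cmd.seq (sample 10) reset).ert J (σ.write 3 (σ 9 0) v) ≤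
      ((2 * n + 8 : ℕ) : ENNReal) + blockAvg (blockSet n blk) (σ 10 0) h
        (Function.update (σ 3) (σ 9 0) v) := by
    intro v hv
    have hρ := hσ.write_rep (t := l) hv fun i hi => Or.inl hi
    have hρ10 : σ.write 3 (σ 9 0) v 10 0 = σ 10 0 := by rw [Store.write_of_ne _ (by omega)]
    have hs := ert_sample_le (a := 10) hρ.toLoaded (by omega) (by rw [hρ10]; exact hB _ h10)
      (g := reset.ert J) (h := fun y => 5 + h y) (by
        intro w hw
        have := h1 _ (hρ.write_rep (t := l) hw fun i hi => Or.inl hi)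
        rwa [Store.write_self] at this)
    rw [hρ10, blockAvg_const_add (hB _ h10), Store.write_self] at hs
    rw [Cmd.ert]
    refine le_trans (add_le_add_right hs _) ?_
    refine le_trans (le_of_eq ?_) (natCast_add_le (a := 2 * n + 7) (by omega) _)
    push_cast
    ring
  have hs := ert_sample_le (a := 9) hσ.toLoaded (by omega) (hB _ h9)
    (h := fun y => ((2 * n + 8 : ℕ) : ENNReal) + blockAvg (blockSet n blk) (σ 10 0) h y) h2
  rw [blockAvg_const_add (hB _ h9)] at hs
  rw [resample, Cmd.ert]
  refine le_trans (add_le_add_right hs _) ?_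
  refine le_trans (le_of_eq ?_) (natCast_add_le (a := 4 * n + 10) (by omega) _)
  push_cast
  ring

/-- The first end of edge number `r` on a triple of blocks. -/
def firstEnd (r i j m : ℕ) : ℕ := if r = 0 then i else if r = 1 then j else m

theorem ert_fix_le (hB : ∀ i < l, (blockSet n blk i).Nonempty) {σ : Store}
    (hσ : Ready n l blk adj l σ) (h5 : σ 5 0 < l) (h6 : σ 6 0 < l) (h7 : σ 7 0 < l) (κ : ℕ)
    {J : Store → ENNReal} {h : (ℕ → ℕ) → ENNReal}
    (hJ : ∀ τ, Ready n l blk adj l τ → τ 5 0 = 0 → τ 6 0 = 0 → τ 7 0 = 0 → J τ ≤ h (τ 3)) :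
    (fix κ).ert J σ ≤ 2 + ∑ r ∈ Finset.range (κ + 1), ((κ : ENNReal) + 1)⁻¹ *
      (((4 * n + 30 : ℕ) : ENNReal) +
        blockAvg (blockSet n blk) (firstEnd r (σ 5 0) (σ 6 0) (σ 7 0))
          (blockAvg (blockSet n blk) (firstEnd r (σ 6 0) (σ 7 0) (σ 5 0)) h) (σ 3)) := by
  have key : ∀ (r c p q : ℕ), c ≤ 10 → p < l → q < l →
      ((c : ℕ) : ENNReal) + resample.ert J (((σ.write 8 0 r).write 9 0 p).write 10 0 q) ≤
      (((4 * n + 30 : ℕ) : ENNReal) +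
        blockAvg (blockSet n blk) p (blockAvg (blockSet n blk) q h) (σ 3)) := by
    intro r c p q hc hp hq
    set τ := ((σ.write 8 0 r).write 9 0 p).write 10 0 q with hτ
    have h9 : τ 9 0 = p := by simp [hτ, Store.write_of_ne, Store.write_self]
    have h10 : τ 10 0 = q := by simp [hτ, Store.write_self]
    have h3 : τ 3 = σ 3 := by simp [hτ, Store.write_of_ne]
    have hr : Ready n l blk adj l τ :=
      ((hσ.write (by omega) 0 r).write (by omega) 0 p).write (by omega) 0 q
    have := ert_resample_le hB hr (by rwa [h9]) (by rwa [h10]) hJ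
    rw [h9, h10, h3] at this
    refine le_trans (add_le_add_right this _) ?_
    rw [← add_assoc, ← Nat.cast_add]
    exact natCast_add_le (by omega) _
  rw [fix, Cmd.ert_seq, Cmd.ert]
  simp only [Cmd.ert_branch, Cmd.ert_assign, Cmd.ert_seq, Expr.eval]
  rw [← add_assoc, one_add_one_eq_two]
  refine add_le_add_right (Finset.sum_le_sum fun r _ => mul_le_mul_right ?_ _) _
  have e8 : σ.write 8 0 r 8 0 = r := by simp [Store.write_self]
  have e5 : σ.write 8 0 r 5 0 = σ 5 0 := by simp [Store.write_of_ne]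
  have e6 : σ.write 8 0 r 6 0 = σ 6 0 := by simp [Store.write_of_ne]
  have e7 : σ.write 8 0 r 7 0 = σ 7 0 := by simp [Store.write_of_ne]
  have e5' : ∀ p, (σ.write 8 0 r).write 9 0 p 5 0 = σ 5 0 := by simp [Store.write_of_ne]
  have e6' : ∀ p, (σ.write 8 0 r).write 9 0 p 6 0 = σ 6 0 := by simp [Store.write_of_ne]
  have e7' : ∀ p, (σ.write 8 0 r).write 9 0 p 7 0 = σ 7 0 := by simp [Store.write_of_ne]
  simp only [e8, e5, e6, e7, e5', e6', e7', firstEnd]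
  by_cases hr : r = 0
  · simp only [hr, if_true, beq_self_eq_true, cond_true]
    refine le_trans (le_of_eq ?_) (key 0 5 _ _ (by omega) h5 h6)
    push_cast
    ring
  · by_cases hr1 : r = 1
    · simp only [hr1, one_ne_zero, if_true, if_false, Nat.sub_self, beq_self_eq_true,
        cond_true, show (1 == 0) = false from rfl, cond_false]
      refine le_trans (le_of_eq ?_) (key 1 6 _ _ (by omega) h6 h7)
      push_cast
      ring
    · simp only [hr, hr1, if_false, beq_eq_false_iff_ne.2 hr,
        beq_eq_false_iff_ne.2 (show r - 1 ≠ 0 by omega), cond_false]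
      refine le_trans (le_of_eq ?_) (key r 6 _ _ (by omega) h7 h5)
      push_cast
      ring

theorem ert_advance_le {σ : Store} (hσ : Ready n l blk adj l σ) (h6 : σ 6 0 < l)
    (h7 : σ 7 0 < l) (J : Store → ENNReal) :
    ∃ τ, advance.ert J σ ≤ 15 + J τ ∧ Ready n l blk adj l τ ∧ τ 3 = σ 3 ∧
      ((σ 7 0 + 1 < l ∧ τ 5 0 = σ 5 0 ∧ τ 6 0 = σ 6 0 ∧ τ 7 0 = σ 7 0 + 1) ∨
       (σ 7 0 + 1 = l ∧ σ 6 0 + 1 < l ∧ τ 5 0 = σ 5 0 ∧ τ 6 0 = σ 6 0 + 1 ∧ τ 7 0 = 0) ∨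
       (σ 7 0 + 1 = l ∧ σ 6 0 + 1 = l ∧ τ 5 0 = σ 5 0 + 1 ∧ τ 6 0 = 0 ∧ τ 7 0 = 0)) := by
  have hl : ∀ a, 3 ≤ a → ∀ i x, σ.write a i x 0 1 = l := fun a ha i x =>
    (hσ.toLoaded.write ha i x).blocks
  rw [advance]
  simp only [Cmd.ert_branch, Cmd.ert_assign, Cmd.ert_seq, Cmd.ert_nop, Expr.eval]
  rw [hl 7 (by omega), show σ.write 7 0 (σ 7 0 + 1) 7 0 = σ 7 0 + 1 by simp [Store.write_self]]
  by_cases c7 : σ 7 0 + 1 < l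
  · refine ⟨σ.write 7 0 (σ 7 0 + 1), ?_, hσ.write (by omega) _ _,
      by simp [Store.write_of_ne], Or.inl ⟨c7, ?_, ?_, ?_⟩⟩
    · rw [beq_eq_false_iff_ne.2 (by omega), cond_false]
      calc _ = ((4 : ℕ) : ENNReal) + J (σ.write 7 0 (σ 7 0 + 1)) := by push_cast; ring
        _ ≤ _ := natCast_add_le (b := 15) (by omega) _
    all_goals simp [Store.write_of_ne, Store.write_self]
  · set τ₁ := ((σ.write 7 0 (σ 7 0 + 1)).write 7 0 0).write 6 0 (σ 6 0 + 1) with hτ₁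
    have hr₁ : Ready n l blk adj l τ₁ :=
      ((hσ.write (by omega) _ _).write (by omega) _ _).write (by omega) _ _
    have e6 : (σ.write 7 0 (σ 7 0 + 1)).write 7 0 0 6 0 = σ 6 0 := by simp [Store.write_of_ne]
    have e61 : τ₁ 6 0 = σ 6 0 + 1 := by simp [hτ₁, Store.write_self]
    rw [beq_iff_eq.2 (by omega), cond_true, e6, ← hτ₁, hr₁.blocks, e61]
    by_cases c6 : σ 6 0 + 1 < l
    · refine ⟨τ₁, ?_, hr₁, by simp [hτ₁, Store.write_of_ne],
        Or.inr (Or.inl ⟨by omega, c6, ?_, e61, ?_⟩)⟩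
      · rw [beq_eq_false_iff_ne.2 (by omega), cond_false]
        calc _ = ((9 : ℕ) : ENNReal) + J τ₁ := by push_cast; ring
          _ ≤ _ := natCast_add_le (b := 15) (by omega) _
      all_goals simp [hτ₁, Store.write_of_ne, Store.write_self]
    · refine ⟨(τ₁.write 6 0 0).write 5 0 (σ 5 0 + 1), ?_,
        (hr₁.write (by omega) _ _).write (by omega) _ _,
        by simp [hτ₁, Store.write_of_ne], Or.inr (Or.inr ⟨by omega, by omega, ?_, ?_, ?_⟩)⟩
      · rw [beq_iff_eq.2 (by omega), cond_true, show τ₁.write 6 0 0 5 0 = σ 5 0 by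
          simp [hτ₁, Store.write_of_ne]]
        calc _ = ((11 : ℕ) : ENNReal) + J ((τ₁.write 6 0 0).write 5 0 (σ 5 0 + 1)) := by
              push_cast; ring
          _ ≤ _ := natCast_add_le (b := 15) (by omega) _
      all_goals simp [hτ₁, Store.write_of_ne, Store.write_self]

/-- The triple of blocks `(a, b, c)` is searched before `(i, j, m)`. -/
def Before (a b c i j m : ℕ) : Prop := a < i ∨ a = i ∧ (b < j ∨ b = j ∧ c < m)

theorem position_lt {i j m : ℕ} (hi : i < l) (hj : j < l) (hm : m < l) :
    (i * l + j) * l + m < l * l * l := by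
  have h1 : i * l + j + 1 ≤ l * l := by
    have := Nat.mul_le_mul_right l (Nat.succ_le_of_lt hi)
    rw [Nat.succ_mul] at this
    omega
  have h2 := Nat.mul_le_mul_right l h1
  rw [Nat.succ_mul] at h2
  omega

/-- Amortized analysis. The constant `D` pays for one resampling together with the complete scan
restarted after it, and the expected unit drop of `Φ` provides that amount. -/
theorem ert_search_le (hB : ∀ i < l, (blockSet n blk i).Nonempty) {κ : ℕ} {test : Expr}
    {Bad : ℕ → ℕ → ℕ → Prop} {Φ : (ℕ → ℕ) → ENNReal}
    (htest : ∀ τ, Ready n l blk adj l τ → τ 5 0 < l → τ 6 0 < l → τ 7 0 < l →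
      (test.eval τ ≠ 0 ↔ Bad (τ 3 (τ 5 0)) (τ 3 (τ 6 0)) (τ 3 (τ 7 0))))
    (hΦ : ∀ x : ℕ → ℕ, (∀ i < l, x i ∈ blockSet n blk i) → ∀ i < l, ∀ j < l, ∀ m < l,
      Bad (x i) (x j) (x m) → ∑ r ∈ Finset.range (κ + 1), ((κ : ENNReal) + 1)⁻¹ *
        blockAvg (blockSet n blk) (firstEnd r i j m)
          (blockAvg (blockSet n blk) (firstEnd r j m i) (fun y => 1 + Φ y)) x ≤ Φ x)
    {g : Store → ENNReal} (hg : ∀ τ, Ready n l blk adj l τ →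
      (∀ a < l, ∀ b < l, ∀ c < l, ¬ Bad (τ 3 a) (τ 3 b) (τ 3 c)) → g τ = 0)
    {σ : Store} (hσ : Ready n l blk adj l σ) (h5 : σ 5 0 = 0) (h6 : σ 6 0 = 0)
    (h7 : σ 7 0 = 0) :
    (search κ test).ert g σ ≤ ((1 + 20 * (l * l * l) : ℕ) : ENNReal) +
      ((20 * (l * l * l) + 4 * n + 50 : ℕ) : ENNReal) * Φ (σ 3) := by
  set D : ENNReal := ((20 * (l * l * l) + 4 * n + 50 : ℕ) : ENNReal) with hD
  refine le_trans (Cmd.ert_loop_le_of_inv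
    (P := fun ρ => Ready n l blk adj l ρ ∧ (ρ 5 0 < l ∧ ρ 6 0 < l ∧ ρ 7 0 < l ∨ ρ 5 0 = l) ∧
      ∀ a < l, ∀ b < l, ∀ c < l, Before a b c (ρ 5 0) (ρ 6 0) (ρ 7 0) →
        ¬ Bad (ρ 3 a) (ρ 3 b) (ρ 3 c))
    -- The first term pays for the rest of the current scan, with the three counters read as digits
    -- in base `l`; the second pays for all future resamplings.
    (I := fun ρ => ((1 + 20 * (l * l * l - ((ρ 5 0 * l + ρ 6 0) * l + ρ 7 0)) : ℕ) : ENNReal) +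
      D * Φ (ρ 3)) ?_ ?_ ⟨hσ, ?_, ?_⟩) ?_
  · rintro ρ ⟨hρ, h1, h2⟩ h0
    simp only [Expr.eval, hρ.blocks] at h0
    rw [hg ρ hρ fun a ha b hb c hc => h2 a ha b hb c hc (Or.inl (by omega)), add_zero]
    refine le_trans ?_ le_self_add
    rw [← Nat.cast_one, Nat.cast_le]
    omega
  · rintro ρ J hJ ⟨hρ, h1, h2⟩ h0
    simp only [Expr.eval, hρ.blocks] at h0
    obtain ⟨i5, i6, i7⟩ := h1.resolve_right (by omega)
    have hpos := position_lt i5 i6 i7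
    rw [Cmd.ert_branch]
    by_cases ht : test.eval ρ = 0
    · rw [beq_iff_eq.2 ht, cond_true]
      have hnb : ¬ Bad (ρ 3 (ρ 5 0)) (ρ 3 (ρ 6 0)) (ρ 3 (ρ 7 0)) := fun h =>
        (htest ρ hρ i5 i6 i7).2 h ht
      obtain ⟨τ, hτ, hr, h3, hcase⟩ := ert_advance_le hρ i6 i7 J
      have hP : (τ 5 0 < l ∧ τ 6 0 < l ∧ τ 7 0 < l ∨ τ 5 0 = l) ∧
          (τ 5 0 * l + τ 6 0) * l + τ 7 0 = (ρ 5 0 * l + ρ 6 0) * l + ρ 7 0 + 1 := by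
        rcases hcase with ⟨c1, c2, c3, c4⟩ | ⟨c1, c2, c3, c4, c5⟩ | ⟨c1, c2, c3, c4, c5⟩
        · rw [c2, c3, c4]
          exact ⟨by omega, by ring⟩
        · rw [c3, c4, c5]
          refine ⟨by omega, ?_⟩
          rw [← add_assoc, Nat.succ_mul]
          omega
        · rw [c3, c4, c5]
          refine ⟨by omega, ?_⟩
          rw [add_assoc _ (ρ 7 0), c1, ← Nat.succ_mul, Nat.succ_eq_add_one, add_assoc _ (ρ 6 0),
            c2]
          ring
      have hnext : ∀ a < l, ∀ b < l, ∀ c < l, Before a b c (τ 5 0) (τ 6 0) (τ 7 0) →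
          ¬ Bad (τ 3 a) (τ 3 b) (τ 3 c) := by
        intro a ha b hb c hc h
        rw [h3]
        by_cases hbef : Before a b c (ρ 5 0) (ρ 6 0) (ρ 7 0)
        · exact h2 a ha b hb c hc hbef
        · have : a = ρ 5 0 ∧ b = ρ 6 0 ∧ c = ρ 7 0 := by
            unfold Before at h hbef
            omega
          obtain ⟨rfl, rfl, rfl⟩ := this
          exact hnb
      have hJτ := hJ τ ⟨hr, hP.1, hnext⟩
      rw [hP.2, h3] at hJτ
      refine le_trans (add_le_add_right (add_le_add_right hτ _) _) ?_
      rw [hJτ]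
      refine le_trans (le_of_eq ?_) (natCast_add_le
        (a := 17 + (1 + 20 * (l * l * l - ((ρ 5 0 * l + ρ 6 0) * l + ρ 7 0 + 1))))
        (by omega) _)
      push_cast
      ring
    · rw [beq_eq_false_iff_ne.2 ht, cond_false]
      have hbad := (htest ρ hρ i5 i6 i7).1 ht
      have hx := hΦ (ρ 3) hρ.mem _ i5 _ i6 _ i7 hbad
      have hfix := ert_fix_le hB hρ i5 i6 i7 κ (J := J)
        (h := fun y => ((1 + 20 * (l * l * l) : ℕ) : ENNReal) + D * Φ y) (by
          intro τ hτ t5 t6 t7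
          rw [hJ τ ⟨hτ, by omega, fun a _ b _ c _ h => by unfold Before at h; omega⟩, t5, t6, t7]
          simp)
      refine le_trans (add_le_add_right (add_le_add_right hfix _) _) ?_
      refine le_trans ?_ le_add_self
      have hκ0 : ((κ : ENNReal) + 1) ≠ 0 := by simp
      have hκt : ((κ : ENNReal) + 1) ≠ ⊤ := by simp
      -- The fixed overhead is spread over the `κ + 1` random choices, so that the comparison with
      -- `hx` can be made term by term.
      have hone : ∑ r ∈ Finset.range (κ + 1), ((κ : ENNReal) + 1)⁻¹ * 4 = 4 := by
        rw [Finset.sum_const, Finset.card_range, nsmul_eq_mul, ← mul_assoc]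
        push_cast
        rw [ENNReal.mul_inv_cancel hκ0 hκt, one_mul]
      rw [← add_assoc, ← add_assoc, show (1 : ENNReal) + 1 + 2 = 4 by norm_num]
      nth_rw 1 [← hone]
      rw [← Finset.sum_add_distrib]
      refine le_trans ?_ (mul_le_mul_right hx D)
      rw [Finset.mul_sum]
      refine Finset.sum_le_sum fun r _ => ?_
      have hends : firstEnd r (ρ 5 0) (ρ 6 0) (ρ 7 0) < l ∧
          firstEnd r (ρ 6 0) (ρ 7 0) (ρ 5 0) < l := by
        unfold firstEnd
        split_ifs <;> exact ⟨by assumption, by assumption⟩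
      rw [← mul_add, mul_left_comm D]
      refine mul_le_mul' le_rfl ?_
      rw [show blockAvg (blockSet n blk) (firstEnd r (ρ 6 0) (ρ 7 0) (ρ 5 0)) (fun y =>
            ((1 + 20 * (l * l * l) : ℕ) : ENNReal) + D * Φ y) = _ from
          funext (blockAvg_const_add (hB _ hends.2) _ _), blockAvg_const_add (hB _ hends.1),
        show blockAvg (blockSet n blk) (firstEnd r (ρ 6 0) (ρ 7 0) (ρ 5 0)) (fun y => D * Φ y) = _
          from funext (blockAvg_mul _ _ _), blockAvg_mul,
        show blockAvg (blockSet n blk) (firstEnd r (ρ 6 0) (ρ 7 0) (ρ 5 0)) (fun y => 1 + Φ y) = _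
          from funext (blockAvg_const_add (hB _ hends.2) _ _), blockAvg_const_add (hB _ hends.1),
        mul_add D, mul_one, ← add_assoc, ← add_assoc]
      refine add_le_add_left ?_ _
      rw [hD]
      norm_cast
      omega
  · rw [h5, h6, h7]
    omega
  · rw [h5, h6, h7]
    intro a _ b _ c _ h
    unfold Before at h
    omega
  · rw [h5, h6, h7]
    simp

/-- The initial sampling is what makes `hΦ'` applicable: the search starts from independent uniform
representatives, so its expected cost is one scan plus `D` times at most `l`. -/
theorem ert_program_le (hB : ∀ i < l, (blockSet n blk i).Nonempty) {κ : ℕ} {test : Expr}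
    {Bad : ℕ → ℕ → ℕ → Prop} {Φ : (ℕ → ℕ) → ENNReal}
    (htest : ∀ τ, Ready n l blk adj l τ → τ 5 0 < l → τ 6 0 < l → τ 7 0 < l →
      (test.eval τ ≠ 0 ↔ Bad (τ 3 (τ 5 0)) (τ 3 (τ 6 0)) (τ 3 (τ 7 0))))
    (hΦ : ∀ x : ℕ → ℕ, (∀ i < l, x i ∈ blockSet n blk i) → ∀ i < l, ∀ j < l, ∀ m < l,
      Bad (x i) (x j) (x m) → ∑ r ∈ Finset.range (κ + 1), ((κ : ENNReal) + 1)⁻¹ *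
        blockAvg (blockSet n blk) (firstEnd r i j m)
          (blockAvg (blockSet n blk) (firstEnd r j m i) (fun y => 1 + Φ y)) x ≤ Φ x)
    (hΦ' : ∀ x, blocksAvg (blockSet n blk) l 0 Φ x ≤ l)
    {g : Store → ENNReal} (hg : ∀ τ, Ready n l blk adj l τ →
      (∀ a < l, ∀ b < l, ∀ c < l, ¬ Bad (τ 3 a) (τ 3 b) (τ 3 c)) → g τ = 0)
    {σ : Store} (hσ : Loaded n l blk adj σ) (h0 : ∀ a, 3 ≤ a → σ a 0 = 0) :
    (program κ test).ert g σ ≤ ((10 + 4 * n + (2 * n + 4) * l + 20 * (l * l * l) +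
      (20 * (l * l * l) + 4 * n + 50) * l : ℕ) : ENNReal) := by
  set D : ENNReal := ((20 * (l * l * l) + 4 * n + 50 : ℕ) : ENNReal) with hD
  set N : ENNReal := ((1 + 20 * (l * l * l) : ℕ) : ENNReal) with hN
  have hsearch : ∀ τ, Ready n l blk adj l τ → τ 6 0 = 0 → τ 7 0 = 0 →
      (Cmd.seq (.assign 5 (.lit 0) (.lit 0)) (search κ test)).ert g τ ≤ (2 + N) + D * Φ (τ 3) := by
    intro τ hτ h6 h7
    have := ert_search_le hB htest hΦ hg (hτ.write (a := 5) (by omega) 0 0)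
      (by simp [Store.write_self]) (by rwa [Store.write_of_ne _ (by omega)])
      (by rwa [Store.write_of_ne _ (by omega)])
    rw [Store.write_of_ne (b := 3) _ (by omega)] at this
    rw [Cmd.ert_seq, Cmd.ert_assign, ← add_assoc, one_add_one_eq_two, add_assoc]
    exact add_le_add_right this _
  have hsample : ∀ τ, Ready n l blk adj 0 τ → τ 5 0 = 0 → τ 6 0 = 0 → τ 7 0 = 0 →
      (Cmd.seq sampleAll (.seq (.assign 5 (.lit 0) (.lit 0)) (search κ test))).ert g τ ≤
      1 + (((1 + (2 * n + 4) * l : ℕ) : ENNReal) + (2 + N + D * l)) := by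
    intro τ hτ h5 h6 h7
    rw [Cmd.ert_seq]
    refine add_le_add_right ?_ _
    refine le_trans (ert_sampleAll_le hB hτ h5 (F := fun y => (2 + N) + D * Φ y) ?_) ?_
    · intro ρ hρ h6' h7'
      exact hsearch ρ hρ (by rw [h6', h6]) (by rw [h7', h7])
    · refine add_le_add_right ?_ _
      rw [blocksAvg_const_add fun i _ h => hB i (by omega)]
      simp only [blocksAvg_mul]
      exact add_le_add_right (mul_le_mul_right (hΦ' _) _) _
  rw [program, Cmd.ert_seq]
  refine le_trans (add_le_add_right (ert_rows_le hσ (h0 4 (by omega)) (h0 11 (by omega))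
    fun τ hτ h => hsample τ hτ ?_ ?_ ?_) _) ?_
  · rw [h 5 (by omega) (by omega), h0 5 (by omega)]
  · rw [h 6 (by omega) (by omega), h0 6 (by omega)]
  · rw [h 7 (by omega) (by omega), h0 7 (by omega)]
  · rw [hD, hN]
    norm_cast
    omega

end Resampling

/-! ### Graphs with blocks as resampling problems -/

/-- An edge `u v` (`κ = 0`), a path `u v w` (`κ = 1`), or a triangle `u v w` (`κ = 2`). -/
def IsBadTriple {V : Type*} (κ : ℕ) (G : SimpleGraph V) (u v w : V) : Prop :=
  G.Adj u v ∧ (1 ≤ κ → G.Adj v w ∧ u ≠ w) ∧ (2 ≤ κ → G.Adj w u)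

/-- The set contains no bad triple. -/
def AvoidsBadTriples {V : Type*} (κ : ℕ) (G : SimpleGraph V) (A : Set V) : Prop :=
  ∀ u ∈ A, ∀ v ∈ A, ∀ w ∈ A, ¬ IsBadTriple κ G u v w

theorem AvoidsBadTriples.isIndepSet {V : Type*} {G : SimpleGraph V} {A : Set V}
    (h : AvoidsBadTriples 0 G A) : G.IsIndepSet A :=
  fun u hu v hv _ huv => h u hu v hv u hu ⟨huv, by omega, by omega⟩

theorem AvoidsBadTriples.noTriangle {V : Type*} {G : SimpleGraph V} {A : Set V}
    (h : AvoidsBadTriples 2 G A) : NoTriangle G A := by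
  classical
  intro s hs
  obtain ⟨⟨u, hu⟩, ⟨v, hv⟩, ⟨w, hw⟩, huv, huw, hvw, -⟩ := SimpleGraph.is3Clique_iff.1 hs
  exact h u hu v hv w hw ⟨huv, fun _ => ⟨hvw, SimpleGraph.Adj.ne (G := G) huw⟩, fun _ => huw.symm⟩

theorem encard_pair_le {V : Type*} (a b : V) : ({a, b} : Set V).encard ≤ 2 := by
  refine (Set.encard_insert_le _ _).trans_eq ?_
  rw [Set.encard_singleton, one_add_one_eq_two]

/-- Without a path on three vertices, every walk from `a` ends at `a` or at a neighbour, and `a` has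
at most one neighbour. -/
theorem AvoidsBadTriples.noComponentAboveTwo {V : Type*} {G : SimpleGraph V} {A : Set V}
    (h : AvoidsBadTriples 1 G A) : NoComponentAboveTwo G A := by
  have hpath : ∀ u v w : A, (G.induce A).Adj u v → (G.induce A).Adj v w → u = w := by
    intro u v w huv hvw
    by_contra huw
    exact h u u.2 v v.2 w w.2
      ⟨huv, fun _ => ⟨hvw, fun h => huw (Subtype.ext h)⟩, by omega⟩
  intro C
  induction C using SimpleGraph.ConnectedComponent.ind with
  | h a =>
  have hreach : ∀ v, (G.induce A).Reachable a v → v = a ∨ (G.induce A).Adj a v := by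
    rintro v ⟨p⟩
    induction p with
    | nil => exact Or.inl rfl
    | @cons a b c hab p ih =>
      rcases ih with rfl | hbc
      · exact Or.inr hab
      · exact Or.inl (hpath a b c hab hbc).symm
  by_cases hb : ∃ b, (G.induce A).Adj a b
  · obtain ⟨b, hb⟩ := hb
    refine le_trans (Set.encard_le_encard (t := {a, b}) ?_) (encard_pair_le a b)
    intro v hv
    rw [SimpleGraph.ConnectedComponent.mem_supp_iff, SimpleGraph.ConnectedComponent.eq] at hv
    rcases hreach v hv.symm with rfl | hv
    · exact Or.inl rfl
    · exact Or.inr (hpath v a b hv.symm hb)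
  · refine le_trans (Set.encard_le_encard (t := {a, a}) ?_) (encard_pair_le a a)
    intro v hv
    rw [SimpleGraph.ConnectedComponent.mem_supp_iff, SimpleGraph.ConnectedComponent.eq] at hv
    rcases hreach v hv.symm with rfl | hv
    · exact Or.inl rfl
    · exact absurd ⟨v, hv⟩ hb

/-! ### The input graph satisfies the weight condition -/

section Input

variable {n l : ℕ} (G : SimpleGraph (Fin n)) (block : Fin n → Fin l)

theorem inputStore_block (v : Fin n) : inputStore G block 1 v = block v := by
  simp [inputStore]

theorem inputStore_matrix (u v : Fin n) [Decidable (G.Adj u v)] :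
    inputStore G block 2 (u * n + v) = if G.Adj u v then 1 else 0 := by
  have hinj : ∀ u' v' : Fin n, u.val * n + v.val = u'.val * n + v'.val → u' = u ∧ v' = v := by
    intro u' v' h
    have hn : 0 < n := u.pos
    have h1 := congrArg (· / n) h
    have h2 := congrArg (· % n) h
    simp only [Nat.mul_comm _ n, Nat.mul_add_div hn, Nat.div_eq_of_lt v.2,
      Nat.div_eq_of_lt v'.2, Nat.mul_add_mod, Nat.mod_eq_of_lt v.2, Nat.mod_eq_of_lt v'.2] at h1 h2
    exact ⟨Fin.ext (by omega), Fin.ext h2.symm⟩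
  have hiff : (∃ u' v' : Fin n, u.val * n + v.val = u'.val * n + v'.val ∧ G.Adj u' v') ↔
      G.Adj u v := by
    constructor
    · rintro ⟨u', v', h, hadj⟩
      obtain ⟨rfl, rfl⟩ := hinj u' v' h
      exact hadj
    · exact fun h => ⟨u, v, rfl, h⟩
  simp only [inputStore, hiff]

open Classical in
/-- The edges between different blocks, oriented towards the larger block. -/
noncomputable def crossEdges : Finset (ℕ × ℕ) :=
  ((Finset.univ : Finset (Fin n × Fin n)).filter
    (fun e => G.Adj e.1 e.2 ∧ block e.1 < block e.2)).image (fun e => (e.1.val, e.2.val))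

theorem mem_crossEdges {e : ℕ × ℕ} : e ∈ crossEdges G block ↔
    ∃ u v : Fin n, G.Adj u v ∧ block u < block v ∧ e = (u.val, v.val) := by
  simp only [crossEdges, Finset.mem_image, Finset.mem_filter, Finset.mem_univ, true_and,
    Prod.exists]
  constructor
  · rintro ⟨u, v, ⟨h1, h2⟩, rfl⟩
    exact ⟨u, v, h1, h2, rfl⟩
  · rintro ⟨u, v, h1, h2, rfl⟩
    exact ⟨u, v, ⟨h1, h2⟩, rfl⟩

theorem mem_blockSet_inputStore {v : Fin n} {i : ℕ} :
    v.val ∈ blockSet n (inputStore G block 1) i ↔ (block v).val = i := by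
  rw [mem_blockSet, inputStore_block]
  simp

theorem exists_of_mem_blockSet {i v : ℕ} (h : v ∈ blockSet n (inputStore G block 1) i) :
    ∃ u : Fin n, u.val = v ∧ (block u).val = i := by
  obtain ⟨hv, -⟩ := mem_blockSet.1 h
  exact ⟨⟨v, hv⟩, rfl, (mem_blockSet_inputStore G block (v := ⟨v, hv⟩)).1 h⟩

theorem card_blockSet (i : Fin l) : (blockSet n (inputStore G block 1) i).card =
    (Finset.univ.filter (fun v => block v = i)).card := by
  refine (Finset.card_bij (fun v _ => v.val) ?_ ?_ ?_).symm
  · intro v hv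
    rw [mem_blockSet_inputStore, (Finset.mem_filter.1 hv).2]
  · exact fun u _ v _ h => Fin.ext h
  · intro v hv
    obtain ⟨u, rfl, hu⟩ := exists_of_mem_blockSet G block hv
    exact ⟨u, by simpa using Fin.ext hu, rfl⟩

-- Each edge at the block is the image of a vertex of the block together with one of its neighbours.
-- Edges inside the block are dropped, since no transversal contains them.
open Classical in
theorem card_crossEdges_le [DecidableRel G.Adj] (i : Fin l) :
    ((crossEdges G block).filter (EdgeMeetsBlock (inputStore G block 1) · i)).card ≤
      ∑ v ∈ Finset.univ.filter (fun v => block v = i), G.degree v := by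
  have hcard : ∑ v ∈ Finset.univ.filter (fun v => block v = i), G.degree v =
      ((Finset.univ.filter (fun v => block v = i)).sigma fun v => G.neighborFinset v).card := by
    simp [Finset.card_sigma]
  rw [hcard]
  refine le_trans (Finset.card_le_card ?_) (Finset.card_image_le (f := fun p : (_ : Fin n) × Fin n =>
    if block p.1 < block p.2 then (p.1.val, p.2.val) else (p.2.val, p.1.val)))
  intro e he
  obtain ⟨he, hi⟩ := Finset.mem_filter.1 he
  obtain ⟨u, v, hadj, hlt, rfl⟩ := (mem_crossEdges G block).1 he
  simp only [EdgeMeetsBlock, inputStore_block] at hi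
  rw [Finset.mem_image]
  rcases hi with hi | hi
  · exact ⟨⟨u, v⟩, by simpa [hadj] using Fin.ext hi, by simp [hlt]⟩
  · exact ⟨⟨v, u⟩, by simpa [hadj.symm] using Fin.ext hi, by simp [hlt.not_gt]⟩

/-- Of the two block sizes in an edge's weight, one is exactly the size `m` of block `i` and cancels
the `m` in the bound `d * m` on its degree sum. This is why an average degree suffices; the other
size is only bounded below. -/
theorem isResamplingInstance [DecidableRel G.Adj] {b : ℕ} {d : ℝ} (κ : ℕ)
    (h : IsBlockPartition G block b d) (hd : 4 / ((κ : ℝ) + 1) * d ≤ b) :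
    IsResamplingInstance (blockSet n (inputStore G block 1)) (inputStore G block 1)
      (crossEdges G block) (κ + 1) l where
  block_nonempty i hi := by
    obtain ⟨v, hv⟩ := h.nonempty ⟨i, hi⟩
    exact ⟨v, by rw [mem_blockSet_inputStore, hv]⟩
  mem_block e he := by
    obtain ⟨u, v, -, -, rfl⟩ := (mem_crossEdges G block).1 he
    simp only [inputStore_block, mem_blockSet_inputStore, and_self]
  blk_lt e he := by
    obtain ⟨u, v, -, -, rfl⟩ := (mem_crossEdges G block).1 he
    simp only [inputStore_block, Fin.is_lt, and_self]
  blk_ne e he := by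
    obtain ⟨u, v, -, hlt, rfl⟩ := (mem_crossEdges G block).1 he
    simp only [inputStore_block]
    exact fun h => hlt.ne (Fin.ext h)
  sum_le i hi := by
    set blk := inputStore G block 1 with hblk
    intro _
    set S := ∑ v ∈ Finset.univ.filter (fun v => block v = ⟨i, hi⟩), G.degree v with hS
    -- The hypotheses allow `b = 0`; the maximum with `1`, available because blocks are nonempty,
    -- keeps the inverses finite.
    have hcard : ∀ j : Fin l, max b 1 ≤ (blockSet n blk j).card := by
      intro j
      obtain ⟨v, hv⟩ := h.nonempty j
      refine max_le ?_ (Finset.card_pos.2 ⟨v, by rw [mem_blockSet_inputStore, hv]⟩)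
      rw [card_blockSet]
      exact h.size j
    set m := (blockSet n blk i).card with hm
    have hmpos : 0 < m := lt_of_lt_of_le (by simp) (hcard ⟨i, hi⟩)
    have hmR : (0 : ℝ) < m := by exact_mod_cast hmpos
    have hκR : (0 : ℝ) < (κ : ℝ) + 1 := by positivity
    have hSd : (S : ℝ) ≤ d * m := by
      have := h.avgDegree ⟨i, hi⟩
      rw [blockAvgDegree, ← card_blockSet G block, ← hblk, ← hm, ← Nat.cast_sum, ← hS,
        div_le_iff₀ hmR] at this
      exact this
    have hSm : 4 * S ≤ (κ + 1) * m * max b 1 := by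
      have h1 : 4 * d ≤ (κ + 1) * b := by
        rw [div_mul_eq_mul_div, div_le_iff₀ hκR] at hd
        linarith
      have h2 : (b : ℝ) ≤ (max b 1 : ℕ) := Nat.cast_le.2 (le_max_left _ _)
      have : (4 * S : ℝ) ≤ (κ + 1) * m * (max b 1 : ℕ) := by
        calc (4 * S : ℝ) ≤ 4 * (d * m) := by linarith
          _ = (4 * d) * m := by ring
          _ ≤ ((κ + 1) * b) * m := by gcongr
          _ ≤ ((κ + 1) * (max b 1 : ℕ)) * m := by gcongr
          _ = _ := by ring
      exact_mod_cast this
    have hterm : ∀ e ∈ (crossEdges G block).filter (EdgeMeetsBlock blk · i),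
        ((κ + 1 : ℕ) : ENNReal)⁻¹ * (((blockSet n blk (blk e.1)).card : ENNReal)⁻¹ *
          ((blockSet n blk (blk e.2)).card : ENNReal)⁻¹) ≤
        (((κ + 1) * m * max b 1 : ℕ) : ENNReal)⁻¹ := by
      intro e he
      obtain ⟨he, hei⟩ := Finset.mem_filter.1 he
      obtain ⟨u, v, -, -, rfl⟩ := (mem_crossEdges G block).1 he
      simp only [hblk, EdgeMeetsBlock, inputStore_block] at hei ⊢
      rw [← hblk]
      rw [← ENNReal.mul_inv (by simp) (by simp), ← ENNReal.mul_inv (by simp) (by simp),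
        ENNReal.inv_le_inv, ← Nat.cast_mul, ← Nat.cast_mul, Nat.cast_le, mul_assoc]
      refine Nat.mul_le_mul_left _ ?_
      rcases hei with hei | hei
      · rw [hei]
        exact Nat.mul_le_mul_left _ (hcard _)
      · rw [hei, mul_comm]
        exact Nat.mul_le_mul_right _ (hcard _)
    refine le_trans (Finset.sum_le_sum hterm) ?_
    rw [Finset.sum_const, nsmul_eq_mul]
    set M := (κ + 1) * m * max b 1 with hM
    have hM0 : M ≠ 0 := by positivity
    have hSc : ((crossEdges G block).filter (EdgeMeetsBlock blk · i)).card ≤ S := by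
      classical
      convert card_crossEdges_le G block ⟨i, hi⟩
    rw [← div_eq_mul_inv, ENNReal.div_le_iff (by simpa using hM0) (by simp), mul_comm,
      ← div_eq_mul_inv, ENNReal.le_div_iff_mul_le (by simp) (by simp)]
    norm_cast
    omega

end Input

/-! ### Correctness of the test and of the whole algorithm -/

section Algorithm

variable {n l : ℕ} (G : SimpleGraph (Fin n)) (block : Fin n → Fin l)

/-- The pair of adjacent vertices, oriented towards the larger block. -/
def orientEdge (blk : ℕ → ℕ) (u v : ℕ) : ℕ × ℕ := if blk u < blk v then (u, v) else (v, u)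

theorem blk_orientEdge (blk : ℕ → ℕ) (u v : ℕ) :
    (blk (orientEdge blk u v).1 = blk u ∧ blk (orientEdge blk u v).2 = blk v) ∨
    (blk (orientEdge blk u v).1 = blk v ∧ blk (orientEdge blk u v).2 = blk u) := by
  unfold orientEdge
  split_ifs <;> simp

/-- The bad triples of vertices given by their numbers. -/
def IsBadNatTriple (κ u v w : ℕ) : Prop :=
  ∃ u' v' w' : Fin n, u'.val = u ∧ v'.val = v ∧ w'.val = w ∧ IsBadTriple κ G u' v' w'

theorem isBadNatTriple_val {κ : ℕ} {u v w : Fin n} :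
    IsBadNatTriple G κ u v w ↔ IsBadTriple κ G u v w := by
  constructor
  · rintro ⟨u', v', w', h1, h2, h3, h⟩
    obtain rfl := Fin.ext h1
    obtain rfl := Fin.ext h2
    obtain rfl := Fin.ext h3
    exact h
  · exact fun h => ⟨u, v, w, rfl, rfl, rfl, h⟩

/-- The test whether the representatives of the blocks in variables `5`, `6`, `7` are bad. -/
def badTest : ℕ → Expr
  | 0 => Resampling.adjEntry (Resampling.var 5) (Resampling.var 6)
  | 1 => .sub (.add (Resampling.adjEntry (Resampling.var 5) (Resampling.var 6))
      (Resampling.adjEntry (Resampling.var 6) (Resampling.var 7)))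
      (.add (.lit 1) (.sub (.lit 1) (Resampling.neq (Resampling.var 5) (Resampling.var 7))))
  | _ => .sub (.add (Resampling.adjEntry (Resampling.var 5) (Resampling.var 6))
      (.add (Resampling.adjEntry (Resampling.var 6) (Resampling.var 7))
        (Resampling.adjEntry (Resampling.var 7) (Resampling.var 5)))) (.lit 2)

/-- The tests count adjacencies and subtract a threshold. For a path the threshold is `1` if the end
blocks differ and `2` if they coincide, so two adjacencies survive only with distinct ends.
Distinctness of the end vertices can be read from the blocks, as each block has one representative.
-/
theorem eval_badTest {κ : ℕ} (hκ : κ ≤ 2) {τ : Store}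
    (h : Resampling.Ready n l (inputStore G block 1) (inputStore G block 2) l τ)
    (h5 : τ 5 0 < l) (h6 : τ 6 0 < l) (h7 : τ 7 0 < l) :
    (badTest κ).eval τ ≠ 0 ↔
      IsBadNatTriple G κ (τ 3 (τ 5 0)) (τ 3 (τ 6 0)) (τ 3 (τ 7 0)) := by
  classical
  obtain ⟨u, hu, hub⟩ := exists_of_mem_blockSet G block (h.mem _ h5)
  obtain ⟨v, hv, hvb⟩ := exists_of_mem_blockSet G block (h.mem _ h6)
  obtain ⟨w, hw, hwb⟩ := exists_of_mem_blockSet G block (h.mem _ h7)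
  have hne : τ 5 0 = τ 7 0 ↔ u = w := by
    constructor
    · intro he
      apply Fin.ext
      rw [hu, hw, he]
    · rintro rfl
      omega
  have hadj : ∀ a b : Fin n, τ 2 (τ 4 a + b) = if G.Adj a b then 1 else 0 := fun a b => by
    rw [h.row a a.2, h.matrix, inputStore_matrix]
  rw [← hu, ← hv, ← hw, isBadNatTriple_val, IsBadTriple]
  obtain rfl | rfl | rfl : κ = 0 ∨ κ = 1 ∨ κ = 2 := by omega
  · simp [badTest, Expr.eval, ← hu, ← hv, hadj]
  · simp only [badTest, Expr.eval, ← hu, ← hv, ← hw, hadj, le_refl, forall_const]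
    by_cases h1 : G.Adj u v <;> by_cases h2 : G.Adj v w <;> by_cases h3 : u = w <;>
      simp only [h1, h2, if_true, if_false, true_and, false_and, and_false] <;>
      [(have := hne.2 h3); (have := mt hne.1 h3); (have := hne.2 h3); (have := mt hne.1 h3);
       (have := hne.2 h3); (have := mt hne.1 h3); (have := hne.2 h3); (have := mt hne.1 h3)] <;>
      simp [h3] <;> omega
  · simp only [badTest, Expr.eval, ← hu, ← hv, ← hw, hadj, le_refl, forall_const,
      show 1 ≤ 2 by omega]
    by_cases h1 : G.Adj u v <;> by_cases h2 : G.Adj v w <;> by_cases h3 : G.Adj w u <;>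
      simp [h1, h2, h3]
    rintro rfl
    exact h3.ne rfl

-- The edges of a bad triple lie on pairs taken from at most three blocks, so any two of them share
-- a block. They are distinct because, when `κ ≥ 1`, the three blocks are; for a path this is where
-- `u ≠ w` is needed.
open Resampling in
theorem sum_blockAvg_potential_le_of_bad [DecidableRel G.Adj] {b : ℕ} {d : ℝ} {κ : ℕ}
    (hκ : κ ≤ 2) (h : IsBlockPartition G block b d) (hd : 4 / ((κ : ℝ) + 1) * d ≤ b)
    {x : ℕ → ℕ} (hx : ∀ i < l, x i ∈ blockSet n (inputStore G block 1) i) {i j m : ℕ}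
    (hi : i < l) (hj : j < l) (hm : m < l) (hbad : IsBadNatTriple G κ (x i) (x j) (x m)) :
    ∑ r ∈ Finset.range (κ + 1), ((κ : ENNReal) + 1)⁻¹ *
      blockAvg (blockSet n (inputStore G block 1)) (firstEnd r i j m)
        (blockAvg (blockSet n (inputStore G block 1)) (firstEnd r j m i)
          (fun y => 1 + WitnessTree.potential (blockSet n (inputStore G block 1))
            (inputStore G block 1) (crossEdges G block) (κ + 1) y)) x ≤
      WitnessTree.potential (blockSet n (inputStore G block 1)) (inputStore G block 1)
        (crossEdges G block) (κ + 1) x := by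
  have H := isResamplingInstance G block κ h hd
  set blk := inputStore G block 1 with hblk
  have hxb : ∀ p < l, blk (x p) = p := fun p hp => (mem_blockSet.1 (hx p hp)).2
  obtain ⟨u, v, w, hu, hv, hw, huv, hbad1, hbad2⟩ := hbad
  have hends : ∀ r, firstEnd r i j m < l ∧ firstEnd r j m i < l := fun r => by
    unfold firstEnd
    split_ifs <;> exact ⟨by assumption, by assumption⟩
  have hadj : ∀ r < κ + 1, ∃ a c : Fin n, a.val = x (firstEnd r i j m) ∧
      c.val = x (firstEnd r j m i) ∧ G.Adj a c := by
    intro r hr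
    obtain rfl | rfl | rfl : r = 0 ∨ r = 1 ∨ r = 2 := by omega
    · exact ⟨u, v, hu, hv, huv⟩
    · exact ⟨v, w, hv, hw, (hbad1 (by omega)).1⟩
    · exact ⟨w, u, hw, hu, hbad2 (by omega)⟩
  have hne : ∀ r < κ + 1, firstEnd r i j m ≠ firstEnd r j m i := by
    intro r hr he
    obtain ⟨a, c, ha, hc, hac⟩ := hadj r hr
    exact hac.ne (Fin.ext (by rw [ha, hc, he]))
  let f : Fin (κ + 1) → ℕ × ℕ := fun r =>
    orientEdge blk (x (firstEnd r i j m)) (x (firstEnd r j m i))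
  have hf : ∀ r, (blk (f r).1 = firstEnd r i j m ∧ blk (f r).2 = firstEnd r j m i) ∨
      (blk (f r).1 = firstEnd r j m i ∧ blk (f r).2 = firstEnd r i j m) := by
    intro r
    have := blk_orientEdge blk (x (firstEnd r i j m)) (x (firstEnd r j m i))
    rwa [hxb _ (hends r).1, hxb _ (hends r).2] at this
  have hfE : ∀ r, f r ∈ crossEdges G block := by
    intro r
    obtain ⟨a, c, ha, hc, hac⟩ := hadj r r.2
    have hab : (block a).val = firstEnd r i j m := by
      rw [← inputStore_block G, ha, ← hblk, hxb _ (hends r).1]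
    have hcb : (block c).val = firstEnd r j m i := by
      rw [← inputStore_block G, hc, ← hblk, hxb _ (hends r).2]
    rw [mem_crossEdges]
    simp only [f, orientEdge, hxb _ (hends r).1, hxb _ (hends r).2]
    have := hne r r.2
    split_ifs with hlt
    · exact ⟨a, c, hac, by rw [Fin.lt_def, hab, hcb]; exact hlt, by rw [ha, hc]⟩
    · exact ⟨c, a, hac.symm, by rw [Fin.lt_def, hab, hcb]; omega, by rw [ha, hc]⟩
  have hfx : ∀ r, x (blk (f r).1) = (f r).1 ∧ x (blk (f r).2) = (f r).2 := by
    intro r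
    simp only [f, orientEdge]
    split_ifs <;> simp [hxb _ (hends r).1, hxb _ (hends r).2]
  have hinj : Function.Injective f := by
    intro r s hrs
    have h1 := hf r
    have h2 := hf s
    rw [hrs] at h1
    apply Fin.ext
    have hr := r.2
    have hs := s.2
    rcases Nat.eq_zero_or_pos κ with hκ0 | hκ0
    · omega
    · have hij := hne 0 (by omega)
      have hjm := hne 1 (by omega)
      have him : i ≠ m := by
        rintro rfl
        exact (hbad1 hκ0).2 (Fin.ext (hu.trans hw.symm))
      simp only [firstEnd] at h1 h2 hij hjm
      generalize blk (f s).1 = p at *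
      generalize blk (f s).2 = q at *
      grind
  have hmeet : ∀ r s, EdgesMeet blk (f r) (f s) := by
    intro r s
    have h1 := hf r
    have h2 := hf s
    have hr := r.2
    have hs := s.2
    simp only [firstEnd] at h1 h2
    simp only [EdgesMeet, EdgeMeetsBlock]
    generalize blk (f s).1 = p at *
    generalize blk (f s).2 = q at *
    generalize blk (f r).1 = p' at *
    generalize blk (f r).2 = q' at *
    grind
  refine le_trans (le_of_eq ?_)
    (WitnessTree.sum_blockAvg_potential_le H f hinj hfE hfx hmeet)
  rw [Finset.sum_range]
  refine Finset.sum_congr rfl fun r _ => ?_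
  push_cast
  rcases hf r with ⟨h1, h2⟩ | ⟨h1, h2⟩
  · rw [h1, h2]
  -- The program redraws the two blocks in cyclic order, which may be opposite to the edge's
  -- orientation.
  · rw [h1, h2, blockAvg_comm (hne r r.2)]

theorem constructible_avoidsBadTriples {κ : ℕ} (hκ : κ ≤ 2) :
    ConstructibleInExpectedPolyTime (4 / ((κ : ℝ) + 1)) (fun _ G A => AvoidsBadTriples κ G A) := by
  classical
  refine ⟨Resampling.program κ (badTest κ),
    10 + 4 * Polynomial.X + (2 * Polynomial.X + 4) * Polynomial.X + 20 * Polynomial.X ^ 3 +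
      (20 * Polynomial.X ^ 3 + 4 * Polynomial.X + 50) * Polynomial.X, ?_⟩
  intro n l G _ block b d h hd
  have H := isResamplingInstance G block κ h hd
  -- The time bound involves `l`; nonempty blocks turn it into a polynomial in `n` alone.
  have hl : l ≤ n := by simpa using Fintype.card_le_of_surjective block h.nonempty
  set Post : Store → Prop := fun τ =>
    Resampling.Ready n l (inputStore G block 1) (inputStore G block 2) l τ ∧
      ∀ i < l, ∀ j < l, ∀ m < l, ¬ IsBadNatTriple G κ (τ 3 i) (τ 3 j) (τ 3 m) with hPost
  have hert := Resampling.ert_program_le (κ := κ) (test := badTest κ)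
    (Bad := IsBadNatTriple G κ) (g := fun τ => if Post τ then 0 else ⊤) H.block_nonempty
    (fun τ hτ h5 h6 h7 => eval_badTest G block hκ hτ h5 h6 h7)
    (fun x hx i hi j hj m hm hbad =>
      sum_blockAvg_potential_le_of_bad G block hκ h hd hx hi hj hm hbad)
    (WitnessTree.blocksAvg_potential_le H) (fun τ h1 h2 => if_pos ⟨h1, h2⟩)
    (σ := inputStore G block) ⟨by simp [inputStore], by simp [inputStore], rfl, rfl⟩
    (fun a ha => by
      obtain ⟨a, rfl⟩ := Nat.exists_eq_add_of_le' ha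
      rfl)
  obtain ⟨h1, h2⟩ := expectedTime_le_and_support_of_ert_le (Post := Post)
    (fun ρ hρ => if_neg hρ) (ENNReal.natCast_ne_top _) hert
  refine ⟨h1.trans (Nat.cast_le.2 ?_), fun k σ hσ => ?_⟩
  · simp only [Polynomial.eval_add, Polynomial.eval_mul, Polynomial.eval_pow, Polynomial.eval_X,
      Polynomial.eval_ofNat]
    rw [show n ^ 3 = n * n * n by ring]
    gcongr
  · obtain ⟨hr, hbad⟩ := h2 k σ hσ
    have hrep : ∀ i : Fin l, ∃ v : Fin n, v.val = σ 3 i ∧ block v = i := by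
      intro i
      obtain ⟨v, hv, hb⟩ := exists_of_mem_blockSet G block (hr.mem i i.2)
      exact ⟨v, hv, Fin.ext hb⟩
    constructor
    · intro i
      obtain ⟨v, hv, hb⟩ := hrep i
      refine ⟨v, ⟨⟨i, hv.symm⟩, hb⟩, ?_⟩
      rintro w ⟨⟨j, hj⟩, hw⟩
      obtain ⟨w', hw', hb'⟩ := hrep j
      obtain rfl : w' = w := Fin.ext (hw'.trans hj)
      obtain rfl : j = i := hb'.symm.trans hw
      exact Fin.ext (hj.symm.trans hv.symm)
    · rintro u ⟨i, hi⟩ v ⟨j, hj⟩ w ⟨m, hm⟩ hb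
      apply hbad i i.2 j j.2 m m.2
      rw [hi, hj, hm]
      exact (isBadNatTriple_val G).2 hb

end Algorithm

/-! ### From the algorithm to existence, and the theorem -/

theorem ConstructibleInExpectedPolyTime.mono {c : ℝ}
    {P Q : ∀ n : ℕ, SimpleGraph (Fin n) → Set (Fin n) → Prop}
    (h : ConstructibleInExpectedPolyTime c P) (hPQ : ∀ n G A, P n G A → Q n G A) :
    ConstructibleInExpectedPolyTime c Q := by
  obtain ⟨prog, p, hp⟩ := h
  refine ⟨prog, p, fun n l G _ block b d hG hd => ⟨(hp n l G block b d hG hd).1, fun k σ hσ => ?_⟩⟩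
  exact ((hp n l G block b d hG hd).2 k σ hσ).imp_right (hPQ n G _)

/-- Existence is read off from the algorithm: vertices and blocks are numbered, the program has
finite expected time, so some halted memory has positive probability, and its output is pulled back.
-/
theorem exists_transversal_avoidsBadTriples {V : Type*} {ι : Type*} [Fintype V] [DecidableEq ι]
    (G : SimpleGraph V) [DecidableRel G.Adj] (block : V → ι) {b : ℕ} {d : ℝ}
    (h : IsBlockPartition G block b d) {κ : ℕ} (hκ : κ ≤ 2)
    (hd : 4 / ((κ : ℝ) + 1) * d ≤ b) :
    ∃ A : Set V, IsTransversal block A ∧ AvoidsBadTriples κ G A := by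
  classical
  have : Finite ι := Finite.of_surjective block h.nonempty
  have e : V ≃ Fin (Fintype.card V) := Fintype.equivFin V
  have f : ι ≃ Fin (Nat.card ι) := Finite.equivFin ι
  obtain ⟨prog, p, hp⟩ := constructible_avoidsBadTriples hκ
  have hsum : ∀ i, ∀ (g : V → ℝ),
      ∑ v ∈ Finset.univ.filter (fun v => f (block (e.symm v)) = i), g (e.symm v) =
        ∑ v ∈ Finset.univ.filter (fun v => block v = f.symm i), g v := by
    intro i g
    refine Finset.sum_equiv e.symm (fun v => ?_) (fun v _ => rfl)
    simp [Equiv.eq_symm_apply]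
  have hcard : ∀ i, (Finset.univ.filter (fun v => f (block (e.symm v)) = i)).card =
      (Finset.univ.filter (fun v => block v = f.symm i)).card := by
    intro i
    have := hsum i (fun _ => 1)
    simpa using this
  have hdeg : ∀ v, (G.comap e.symm).degree v = G.degree (e.symm v) := fun v =>
    ((SimpleGraph.Iso.comap e.symm G).degree_eq v).symm
  have h' : IsBlockPartition (G.comap e.symm) (fun v => f (block (e.symm v))) b d := by
    refine ⟨f.surjective.comp (h.nonempty.comp e.symm.surjective), fun i => ?_, fun i => ?_⟩
    · rw [hcard]
      exact h.size _
    · refine le_trans (le_of_eq ?_) (h.avgDegree (f.symm i))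
      rw [blockAvgDegree, blockAvgDegree, hcard, ← hsum i fun v => (G.degree v : ℝ)]
      simp only [hdeg]
  obtain ⟨htime, hout⟩ := hp _ _ _ _ _ _ h' hd
  obtain ⟨k, σ, hσ⟩ := exists_halted_of_expectedTime_ne_top
    (ne_top_of_le_ne_top (ENNReal.natCast_ne_top _) htime)
  obtain ⟨htr, hgood⟩ := hout k σ hσ
  refine ⟨e ⁻¹' outputSet (Fintype.card V) (Nat.card ι) σ, fun i => ?_, ?_⟩
  · obtain ⟨v, ⟨hv, hb⟩, huniq⟩ := htr (f i)
    refine ⟨e.symm v, ⟨by simpa using hv, f.injective hb⟩, ?_⟩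
    rintro w ⟨hw, rfl⟩
    rw [← huniq (e w) ⟨hw, by simp⟩, e.symm_apply_apply]
  · intro u hu v hv w hw hbad
    refine hgood (e u) hu (e v) hv (e w) hw ?_
    simpa [IsBadTriple] using hbad

theorem theorem4p1 :
    (∀ (V : Type*) (ι : Type*) [Fintype V] [DecidableEq ι] (G : SimpleGraph V)
        [DecidableRel G.Adj] (block : V → ι) (b : ℕ) (d : ℝ), IsBlockPartition G block b d →
        (4 * d ≤ (b : ℝ) → ∃ A : Set V, IsTransversal block A ∧ G.IsIndepSet A) ∧
        (2 * d ≤ (b : ℝ) → ∃ A : Set V, IsTransversal block A ∧ NoComponentAboveTwo G A) ∧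
        ((4 / 3) * d ≤ (b : ℝ) → ∃ A : Set V, IsTransversal block A ∧ NoTriangle G A)) ∧
    ConstructibleInExpectedPolyTime 4 (fun _ G A => G.IsIndepSet A) ∧
    ConstructibleInExpectedPolyTime 2 (fun _ G A => NoComponentAboveTwo G A) ∧
    ConstructibleInExpectedPolyTime (4 / 3) (fun _ G A => NoTriangle G A) := by
  have h0 : (4 : ℝ) / ((0 : ℕ) + 1) = 4 := by norm_num
  have h1 : (4 : ℝ) / ((1 : ℕ) + 1) = 2 := by norm_num
  have h2 : (4 : ℝ) / ((2 : ℕ) + 1) = 4 / 3 := by norm_num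
  refine ⟨fun V ι _ _ G _ block b d h => ⟨fun hd => ?_, fun hd => ?_, fun hd => ?_⟩, ?_, ?_, ?_⟩
  · obtain ⟨A, hA, hA'⟩ := exists_transversal_avoidsBadTriples G block h (κ := 0) (by omega)
      (by rwa [h0])
    exact ⟨A, hA, hA'.isIndepSet⟩
  · obtain ⟨A, hA, hA'⟩ := exists_transversal_avoidsBadTriples G block h (κ := 1) (by omega)
      (by rwa [h1])
    exact ⟨A, hA, hA'.noComponentAboveTwo⟩
  · obtain ⟨A, hA, hA'⟩ := exists_transversal_avoidsBadTriples G block h (κ := 2) (by omega)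
      (by rwa [h2])
    exact ⟨A, hA, hA'.noTriangle⟩
  · rw [← h0]
    exact (constructible_avoidsBadTriples (by omega)).mono fun _ _ _ h => h.isIndepSet
  · rw [← h1]
    exact (constructible_avoidsBadTriples (by omega)).mono fun _ _ _ h => h.noComponentAboveTwo
  · rw [← h2]
    exact (constructible_avoidsBadTriples (by omega)).mono fun _ _ _ h => h.noTriangle
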